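/- Let $d\ge 1$, $s\in[\tfrac12,1]$, $T>0$, let $\beta,b\in C^1(\mathbb R)$ with $\beta(0)=0$, let $D\in L^\infty(\mathbb R^d;\mathbb R^d)$ and $\kappa\in\mathbb R$, and assume one of the following: (a) $\beta'(r)>0$ for all $r\in\mathbb R$, $s>\tfrac12$ and $\kappa>0$; (b) $D=0$ almost everywhere, $\beta'(r)\ge0$ for all $r\in\mathbb R$ and $\kappa\ge0$. Let $u\in L^\infty((0,T)\times\mathbb R^d)$, and write $\frac{\beta(u)}{u}$ for the quotient, with the convention $\frac{\beta(0)}{0}:=\kappa$ (for instance $\kappa=\beta'(0)$). Let $u_0$ be a signed measure of finite variation on $\mathbb R^d$, and let $y_1,y_2\in L^\infty((0,T)\times\mathbb R^d)$ be two distributional solutions of $$y_t+(-\Delta)^s\Big(\frac{\beta(u)}{u}\,y\Big)+\operatorname{div}\big(y\,D\,b(u)\big)=0\ \text{ in }(0,T)\times\mathbb R^d,\qquad y(0)=u_0,$$ that is, for $y=y_1$ and $y=y_2$, $$\int_0^T\!\!\int_{\mathbb R^d}\Big(y\,\varphi_t-\frac{\beta(u)}{u}\,y\,(-\Delta)^s\varphi+b(u)\,y\,D\cdot\nabla\varphi\Big)\,dx\,dt+\int_{\mathbb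 R^d}\varphi(0,x)\,u_0(dx)=0\qquad\text{for all }\varphi\in C_0^\infty([0,T)\times\mathbb R^d),$$ where $(-\Delta)^s$ is the Fourier multiplier $|\xi|^{2s}$ acting in $x$. Suppose that $y_1-y_2\in L^1((0,T)\times\mathbb R^d)\cap L^\infty(0,T;L^2(\mathbb R^d))$ and that $$\lim_{t\to0}\ \operatorname*{ess\,sup}_{r\in(0,t)}\Big|\int_{\mathbb R^d}(y_1(r,x)-y_2(r,x))\,\varphi(x)\,dx\Big|=0\qquad\text{for all }\varphi\in C_0^\infty(\mathbb R^d).$$ Then $y_1=y_2$ almost everywhere on $(0,T)\times\mathbb R^d$. -/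

import Mathlib

open MeasureTheory Filter Topology Set
open scoped FourierTransform ContDiff ENNReal NNReal

noncomputable section

/-- The space `ℝ^d` with its Euclidean norm. -/
abbrev RSpace (d : ℕ) : Type := EuclideanSpace ℝ (Fin d)

/-- The space-time cylinder `(0,T) × ℝ^d`. -/
def cylinder (d : ℕ) (T : ℝ) : Set (ℝ × RSpace d) := Ioo 0 T ×ˢ univ

/-- Lebesgue measure on `(0,T) × ℝ^d`. -/
def cylinderMeasure (d : ℕ) (T : ℝ) : Measure (ℝ × RSpace d) :=
  volume.restrict (cylinder d T)

/-- The fractional Laplacian `(-Δ)^s f` of a (test) function `f` on `ℝ^d`, that is, the Fourier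
multiplier `|ξ|^(2s)` in angular frequency. Mathlib's Fourier transform has kernel
`exp (-2πi⟪x, ξ⟫)`, so the multiplier reads `(2π|ξ|)^(2s)`. For real-valued `f` the inverse
transform is real-valued, and `re` only changes the codomain. -/
def fracLaplacian {d : ℕ} (s : ℝ) (f : RSpace d → ℝ) (x : RSpace d) : ℝ :=
  (𝓕⁻ (fun ξ : RSpace d =>
    (((2 * Real.pi * ‖ξ‖) ^ (2 * s) : ℝ) : ℂ) * 𝓕 (fun v : RSpace d => (f v : ℂ)) ξ) x).re

/-- Test functions in `C_0^∞([0,T) × ℝ^d)`: (restrictions to `t ≥ 0` of) smooth functions on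
`ℝ × ℝ^d` with compact support contained in `(-∞,T) × ℝ^d`. They need not vanish at `t = 0`. -/
structure IsSpaceTimeTest {d : ℕ} (T : ℝ) (φ : ℝ × RSpace d → ℝ) : Prop where
  smooth : ContDiff ℝ ∞ φ
  compact : HasCompactSupport φ
  support_lt : tsupport φ ⊆ Iio T ×ˢ univ

/-- The integral of `f` against a signed measure `μ` (of finite variation), through its Jordan
decomposition. -/
def integralSigned {X : Type*} [MeasurableSpace X] (μ : SignedMeasure X) (f : X → ℝ) : ℝ :=
  (∫ x, f x ∂μ.toJordanDecomposition.posPart) - ∫ x, f x ∂μ.toJordanDecomposition.negPart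

/-- The quotient `β(r)/r`, where `β(0)/0` is given the value `κ`. -/
def quot (β : ℝ → ℝ) (κ r : ℝ) : ℝ := if r = 0 then κ else β r / r

/-- `y` is a distributional solution on `(0,T) × ℝ^d`, with initial datum the signed measure `u₀`,
of the linear equation `y_t + (-Δ)^s ((β(u)/u) y) + div (y D b(u)) = 0`, where `β(0)/0 := κ`. -/
def IsLinearizedSolution {d : ℕ} (s T κ : ℝ) (β b : ℝ → ℝ) (D : RSpace d → RSpace d)
    (u : ℝ × RSpace d → ℝ) (u₀ : SignedMeasure (RSpace d)) (y : ℝ × RSpace d → ℝ) : Prop :=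
  ∀ φ : ℝ × RSpace d → ℝ, IsSpaceTimeTest T φ →
    (∫ p, (y p * deriv (fun τ => φ (τ, p.2)) p.1
        - fracLaplacian s (fun x => φ (p.1, x)) p.2 * (quot β κ (u p) * y p)
        + b (u p) * y p * inner ℝ (D p.2) (gradient (fun x => φ (p.1, x)) p.2))
      ∂(cylinderMeasure d T))
      + integralSigned u₀ (fun x => φ (0, x)) = 0

/-- `z ∈ L^∞(0,T; L^2(ℝ^d))`. -/
def InLinftyL2 {d : ℕ} (T : ℝ) (z : ℝ × RSpace d → ℝ) : Prop :=
  ∃ C : ℝ≥0, ∀ᵐ t ∂(volume.restrict (Ioo (0 : ℝ) T)),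
    MemLp (fun x => z (t, x)) 2 volume ∧ eLpNorm (fun x => z (t, x)) 2 volume ≤ C

/-- `lim_{t→0} ess sup_{r ∈ (0,t)} |(z(r), φ)_2| = 0` for all `φ ∈ C_0^∞(ℝ^d)`. -/
def VanishesAtZero {d : ℕ} (z : ℝ × RSpace d → ℝ) : Prop :=
  ∀ φ : RSpace d → ℝ, ContDiff ℝ ∞ φ → HasCompactSupport φ →
    Tendsto (fun t : ℝ => essSup (fun r : ℝ => ENNReal.ofReal |∫ x, z (r, x) * φ x|)
      (volume.restrict (Ioo 0 t))) (𝓝[>] 0) (𝓝 0)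

end

/-! Write `z` for the difference of the two solutions, `w = β(u)/u` and `v = b(u) D`. Then `z`
solves the linear equation `z_t + (-Δ)^s (w z) + div (z v) = 0` with zero initial datum, where `0 ≤
w ≤ W` and `v` is bounded. The proof is an energy estimate in `H^{-s}`: with `q(ξ) = (2π|ξ|)^(2s)`,
the quantity `E(t) = ∫ |ẑ(t,ξ)|² / (1 + q(ξ)) dξ` satisfies `E(t) ≤ C ∫₀ᵗ E`, so it vanishes by
Gronwall.

Differentiating `E` formally produces `-2 Re (conj ẑ · (q (wz)^ + 2πi ξ·(zv)^)) / (1 + q)`. Since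
`q/(1+q) = 1 - 1/(1+q)`, the diffusion contributes `-2 ∫ w z²` by Plancherel, plus a remainder
bounded by Young's inequality by `W E + W⁻¹ ∫ (wz)² ≤ W E + ∫ w z²`. This leaves `-∫ w z²` to absorb
the drift. When `s > 1/2` the drift symbol `2π|ξ|/(1+q)` tends to zero at infinity, so the drift
costs an arbitrarily small multiple of `∫ z²` plus a multiple of `E`, and the lower bound `w ≥ α >
0` suffices. When `D = 0` there is nothing to absorb and `w ≥ 0` is enough. The pointwise estimate
is `rate_le`, its integrated form `integral_energyRate_le`.

The derivation is made rigorous one frequency at a time. Plane waves are limits of test functions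
with uniformly bounded fractional Laplacians and gradients
(`exists_testFunction_tendsto_planeWave`), and `z ∈ L¹` allows passage to the limit. Hence `t ↦
ẑ(t,ξ)` is, for each `ξ`, the primitive of an integrable function vanishing at `0`, and `|ẑ|²` can
be differentiated without regularizing `z` (`ae_norm_spaceFourier_sq_eq`).

Subtracting the two weak formulations also needs care: each solution is only bounded, so `(-Δ)^s f`
must be integrable for every test function `f`. This is `integrable_fracLaplacianC`, obtained for `s
< 1` from the singular integral representation. -/

/-! ### The Lévy kernel and the Lévy–Khintchine formula. -/

/-- The Lévy density of the fractional Laplacian on `ℝ^d`, up to a constant. -/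
noncomputable def levyKernel (d : ℕ) (s : ℝ) (h : RSpace d) : ℝ := ‖h‖ ^ (-(d + 2 * s) : ℝ)

theorem levyKernel_nonneg (d : ℕ) (s : ℝ) (h : RSpace d) : 0 ≤ levyKernel d s h :=
  Real.rpow_nonneg (norm_nonneg _) _

theorem measurable_levyKernel (d : ℕ) (s : ℝ) : Measurable (levyKernel d s) := by
  unfold levyKernel
  fun_prop

/-- In polar coordinates the integrand is `r^(1-2s)` near zero, integrable because `s < 1`, and
`r^(-1-2s)` at infinity, integrable because `s > 0`. -/
theorem integrable_min_mul_levyKernel {d : ℕ} (hd : 1 ≤ d) {s : ℝ} (hs : 1 / 2 ≤ s) (hs1 : s < 1) :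
    Integrable (fun h : RSpace d => min 1 (‖h‖ ^ 2) * levyKernel d s h) := by
  have : Nontrivial (RSpace d) := by
    apply Module.nontrivial_of_finrank_pos (R := ℝ)
    simp; omega
  refine (integrable_fun_norm_addHaar (E := RSpace d) volume
    (f := fun r : ℝ => min 1 (r ^ 2) * r ^ (-(d + 2 * s) : ℝ))).2 ?_
  rw [← Ioc_union_Ioi_eq_Ioi (zero_le_one (α := ℝ))]
  have key : ∀ r : ℝ, 0 < r → r ^ (Module.finrank ℝ (RSpace d) - 1) • (r ^ (-(d + 2 * s) : ℝ)) =
      r ^ (-1 - 2 * s) := by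
    intro r hr
    rw [finrank_euclideanSpace_fin, smul_eq_mul, ← Real.rpow_natCast, ← Real.rpow_add hr]
    congr 1
    push_cast [hd]
    ring
  refine IntegrableOn.union ?_ ?_
  · have h1 : IntegrableOn (fun r : ℝ => r ^ (1 - 2 * s)) (Ioc 0 1) :=
      (intervalIntegrable_iff_integrableOn_Ioc_of_le zero_le_one).1
        (intervalIntegral.intervalIntegrable_rpow' (by linarith))
    refine h1.congr_fun (fun r hr => ?_) measurableSet_Ioc
    have h2 : min 1 (r ^ 2) = r ^ 2 := min_eq_right (by nlinarith [hr.1, hr.2])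
    have h3 := key r hr.1
    simp only [smul_eq_mul, h2] at h3 ⊢
    rw [mul_left_comm, h3, ← Real.rpow_natCast, ← Real.rpow_add hr.1]
    congr 1
    push_cast
    ring
  · have h1 : IntegrableOn (fun r : ℝ => r ^ (-1 - 2 * s)) (Ioi 1) :=
      integrableOn_Ioi_rpow_of_lt (by linarith) one_pos
    refine h1.congr_fun (fun r hr => ?_) measurableSet_Ioi
    have hr' : (1 : ℝ) < r := hr
    have h2 : min 1 (r ^ 2) = 1 := min_eq_left (by nlinarith)
    have h3 := key r (by linarith)
    simp only [h2, one_mul]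
    exact h3.symm

/-- The symbol of the second difference operator with increment `h`. -/
noncomputable def diffSymbol {d : ℕ} (h ξ : RSpace d) : ℝ := 2 - 2 * Real.cos (2 * Real.pi * inner ℝ h ξ)

theorem diffSymbol_nonneg {d : ℕ} (h ξ : RSpace d) : 0 ≤ diffSymbol h ξ := by
  unfold diffSymbol
  linarith [Real.cos_le_one (2 * Real.pi * inner ℝ h ξ)]

theorem continuous_diffSymbol (d : ℕ) : Continuous (fun p : RSpace d × RSpace d => diffSymbol p.1 p.2) := by
  unfold diffSymbol
  fun_prop

theorem diffSymbol_le {d : ℕ} (h ξ : RSpace d) :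
    diffSymbol h ξ ≤ (4 + (2 * Real.pi * ‖ξ‖) ^ 2) * min 1 (‖h‖ ^ 2) := by
  have h1 : diffSymbol h ξ ≤ 4 := by
    unfold diffSymbol
    linarith [Real.neg_one_le_cos (2 * Real.pi * inner ℝ h ξ)]
  have h2 : diffSymbol h ξ ≤ (2 * Real.pi * ‖ξ‖) ^ 2 * ‖h‖ ^ 2 := by
    have h3 := Real.one_sub_sq_div_two_le_cos (x := 2 * Real.pi * inner ℝ h ξ)
    have h4 : (2 * Real.pi * inner ℝ h ξ) ^ 2 ≤ (2 * Real.pi * ‖ξ‖) ^ 2 * ‖h‖ ^ 2 := by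
      rw [← mul_pow]
      apply sq_le_sq'
      · have := neg_le_of_abs_le (abs_real_inner_le_norm h ξ)
        nlinarith [Real.pi_pos]
      · have := le_of_abs_le (abs_real_inner_le_norm h ξ)
        nlinarith [Real.pi_pos]
    unfold diffSymbol
    linarith
  rcases le_total (‖h‖ ^ 2) 1 with h5 | h5
  · rw [min_eq_right h5]
    nlinarith [sq_nonneg ‖h‖]
  · rw [min_eq_left h5]
    nlinarith [sq_nonneg (2 * Real.pi * ‖ξ‖)]

theorem integrable_diffSymbol_mul_levyKernel {d : ℕ} (hd : 1 ≤ d) {s : ℝ} (hs : 1 / 2 ≤ s)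
    (hs1 : s < 1) (ξ : RSpace d) :
    Integrable (fun h : RSpace d => diffSymbol h ξ * levyKernel d s h) := by
  refine ((integrable_min_mul_levyKernel hd hs hs1).const_mul
    (4 + (2 * Real.pi * ‖ξ‖) ^ 2)).mono' ?_ (ae_of_all _ fun h => ?_)
  · exact (((continuous_diffSymbol d).comp (by fun_prop : Continuous fun h : RSpace d =>
      (h, ξ))).measurable.mul (measurable_levyKernel d s)).aestronglyMeasurable
  · rw [Real.norm_of_nonneg (mul_nonneg (diffSymbol_nonneg _ _) (levyKernel_nonneg _ _ _)),
      ← mul_assoc]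
    exact mul_le_mul_of_nonneg_right (diffSymbol_le h ξ) (levyKernel_nonneg _ _ _)

/-- The Lévy–Khintchine formula for `‖ξ‖^(2s)`, `s < 1`. -/
theorem exists_integral_diffSymbol_eq {d : ℕ} (hd : 1 ≤ d) {s : ℝ} (hs : 1 / 2 ≤ s) (hs1 : s < 1) :
    ∃ c : ℝ, 0 < c ∧ ∀ ξ : RSpace d,
      ∫ h : RSpace d, diffSymbol h ξ * levyKernel d s h = c * ‖ξ‖ ^ (2 * s) := by
  have : Nontrivial (RSpace d) := by
    apply Module.nontrivial_of_finrank_pos (R := ℝ)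
    simp; omega
  obtain ⟨e, he⟩ := exists_norm_eq (RSpace d) zero_le_one
  refine ⟨∫ h : RSpace d, diffSymbol h e * levyKernel d s h, ?_, fun ξ => ?_⟩
  · rw [integral_pos_iff_support_of_nonneg
      (fun h => mul_nonneg (diffSymbol_nonneg _ _) (levyKernel_nonneg _ _ _))
      (integrable_diffSymbol_mul_levyKernel hd hs hs1 e)]
    -- On this nonempty open slab the angle lies strictly between `0` and `2π`, so the integrand
    -- does not vanish.
    have hU : IsOpen ((fun h : RSpace d => (inner ℝ h e : ℝ)) ⁻¹' Ioo 0 1) :=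
      isOpen_Ioo.preimage (by fun_prop)
    refine (hU.measure_pos volume ⟨(1 / 2 : ℝ) • e, ?_⟩).trans_le (measure_mono ?_)
    · simp only [mem_preimage, real_inner_smul_left, real_inner_self_eq_norm_sq, he]
      norm_num
    · rintro h ⟨h1, h2⟩
      refine mul_ne_zero ?_ ?_
      · intro h0
        have h3 : Real.cos (2 * Real.pi * inner ℝ h e) = 1 := by
          unfold diffSymbol at h0
          linarith
        rw [Real.cos_eq_one_iff_of_lt_of_lt (by nlinarith [Real.pi_pos])
          (by nlinarith [Real.pi_pos])] at h3
        have : 0 < 2 * Real.pi * inner ℝ h e := mul_pos Real.two_pi_pos h1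
        linarith
      · have : h ≠ 0 := by
          rintro rfl
          simp at h1
        exact (Real.rpow_pos_of_pos (norm_pos_iff.2 this) _).ne'
  · rcases eq_or_ne ξ 0 with rfl | hξ
    · simp [diffSymbol, Real.zero_rpow (by linarith : 2 * s ≠ 0)]
    have hr : 0 < ‖ξ‖ := norm_pos_iff.2 hξ
    -- The reflection exchanging `ξ` and `‖ξ‖ • e`, followed by dilation by `‖ξ‖`, reduces the
    -- integral to the one at `e`. The kernel has homogeneity `-(d + 2s)` and the Jacobian takes
    -- away `d`, leaving the power `2s`.
    set A := (ℝ ∙ (ξ - ‖ξ‖ • e))ᗮ.reflection with hA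
    have hAξ : A ξ = ‖ξ‖ • e := Submodule.reflection_sub (by simp [norm_smul, he])
    set G : RSpace d → ℝ := fun h => diffSymbol h e * levyKernel d s h with hG
    have h1 : ∀ h : RSpace d, diffSymbol h ξ * levyKernel d s h =
        ‖ξ‖ ^ (d + 2 * s : ℝ) * G (‖ξ‖ • A h) := by
      intro h
      have e1 : diffSymbol (‖ξ‖ • A h) e = diffSymbol h ξ := by
        unfold diffSymbol
        rw [real_inner_smul_left, ← real_inner_smul_right, ← hAξ, A.inner_map_map]
      have e2 : ‖ξ‖ ^ (d + 2 * s : ℝ) * levyKernel d s (‖ξ‖ • A h) = levyKernel d s h := by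
        unfold levyKernel
        rw [norm_smul, A.norm_map, norm_norm, Real.mul_rpow (norm_nonneg _) (norm_nonneg _),
          ← mul_assoc, ← Real.rpow_add hr]
        simp
      rw [hG]
      simp only
      rw [e1, mul_left_comm, e2]
    simp_rw [h1]
    rw [integral_const_mul, A.measurePreserving.integral_comp
      A.toHomeomorph.measurableEmbedding (fun x => G (‖ξ‖ • x)),
      Measure.integral_comp_smul, finrank_euclideanSpace_fin, smul_eq_mul, ← mul_assoc, mul_comm]
    congr 1
    rw [abs_of_pos (by positivity), Real.rpow_add hr, Real.rpow_natCast]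
    field_simp

/-! ### Integrability of the fractional Laplacian of a test function. -/

/-- The symbol `(2π‖ξ‖)^(2s)` of the fractional Laplacian. -/
noncomputable def fracSymbol {d : ℕ} (s : ℝ) (ξ : RSpace d) : ℝ := (2 * Real.pi * ‖ξ‖) ^ (2 * s)

theorem fracSymbol_nonneg {d : ℕ} (s : ℝ) (ξ : RSpace d) : 0 ≤ fracSymbol s ξ :=
  Real.rpow_nonneg (by positivity) _

theorem continuous_fracSymbol (d : ℕ) {s : ℝ} (hs : 0 ≤ s) :
    Continuous (fracSymbol s : RSpace d → ℝ) := by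
  unfold fracSymbol
  exact (continuous_const.mul continuous_norm).rpow_const fun _ => Or.inr (by linarith)

theorem rpow_two_mul_le {r s : ℝ} (hr : 0 ≤ r) (hs : 0 ≤ s) (hs1 : s ≤ 1) :
    r ^ (2 * s) ≤ 1 + r ^ 2 := by
  rcases le_total r 1 with h | h
  · have := Real.rpow_le_one hr h (by linarith : 0 ≤ 2 * s)
    nlinarith [sq_nonneg r]
  · have := Real.rpow_le_rpow_of_exponent_le h (by push_cast; linarith : 2 * s ≤ (2 : ℕ))
    rw [Real.rpow_natCast] at this
    linarith

theorem integrable_fracSymbol_mul_norm {d : ℕ} {s : ℝ} (hs : 0 ≤ s) (hs1 : s ≤ 1)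
    (G : SchwartzMap (RSpace d) ℂ) : Integrable (fun ξ => fracSymbol s ξ * ‖G ξ‖) := by
  refine ((G.integrable_pow_mul volume 0).add
    ((G.integrable_pow_mul volume 2).const_mul ((2 * Real.pi) ^ 2))).mono'
    (((continuous_fracSymbol d hs).mul G.continuous.norm).aestronglyMeasurable)
    (ae_of_all _ fun ξ => ?_)
  rw [Real.norm_of_nonneg (mul_nonneg (fracSymbol_nonneg _ _) (norm_nonneg _))]
  have := mul_le_mul_of_nonneg_right
    (rpow_two_mul_le (by positivity : 0 ≤ 2 * Real.pi * ‖ξ‖) hs hs1) (norm_nonneg (G ξ))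
  simp only [fracSymbol, Pi.add_apply]
  calc _ ≤ _ := this
    _ = _ := by ring

/-- The complex-valued fractional Laplacian. -/
noncomputable def fracLaplacianC {d : ℕ} (s : ℝ) (f : RSpace d → ℂ) (x : RSpace d) : ℂ :=
  𝓕⁻ (fun ξ : RSpace d => (fracSymbol s ξ : ℂ) * 𝓕 f ξ) x

theorem fracLaplacian_eq_re {d : ℕ} (s : ℝ) (f : RSpace d → ℝ) (x : RSpace d) :
    fracLaplacian s f x = (fracLaplacianC s (fun v => (f v : ℂ)) x).re := rfl

/-- At `s = 1` the symbol is a polynomial, so the multiplier preserves Schwartz functions. This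
endpoint is separate because the Lévy kernel is then too singular at the origin. -/
theorem integrable_fracLaplacianC_one {d : ℕ} (F : SchwartzMap (RSpace d) ℂ) :
    Integrable (fracLaplacianC 1 (F : RSpace d → ℂ)) := by
  have hg : Function.HasTemperateGrowth (fun ξ : RSpace d => (2 * Real.pi) ^ 2 * ‖ξ‖ ^ 2) := by
    fun_prop
  have h : fracLaplacianC 1 (F : RSpace d → ℂ) = SchwartzMap.fourierMultiplierCLM ℂ
      (fun ξ : RSpace d => (2 * Real.pi) ^ 2 * ‖ξ‖ ^ 2) F := by
    ext x
    rw [SchwartzMap.fourierMultiplierCLM_apply, SchwartzMap.fourierInv_coe]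
    unfold fracLaplacianC
    refine congrArg (fun g : RSpace d → ℂ => 𝓕⁻ g x) (funext fun ξ => ?_)
    rw [SchwartzMap.smulLeftCLM_apply_apply hg, SchwartzMap.fourier_coe]
    simp [fracSymbol, mul_pow]
  rw [h]
  exact SchwartzMap.integrable _

theorem secondDifference_eq_integral {d : ℕ} (F : SchwartzMap (RSpace d) ℂ) (x h : RSpace d) :
    2 * F x - F (x + h) - F (x - h) = ∫ ξ : RSpace d,
      Complex.exp (((2 * Real.pi * inner ℝ ξ x : ℝ) : ℂ) * Complex.I) *
        ((diffSymbol h ξ : ℂ) * 𝓕 F ξ) := by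
  have key : ∀ y, F y = ∫ ξ : RSpace d,
      Complex.exp (((2 * Real.pi * inner ℝ ξ y : ℝ) : ℂ) * Complex.I) * 𝓕 F ξ := by
    intro y
    conv_lhs => rw [← FourierTransform.fourierInv_fourier_eq (F := SchwartzMap (RSpace d) ℂ) F,
      SchwartzMap.fourierInv_coe, Real.fourierInv_eq']
    rfl
  have hint : ∀ y, Integrable (fun ξ : RSpace d =>
      Complex.exp (((2 * Real.pi * inner ℝ ξ y : ℝ) : ℂ) * Complex.I) * 𝓕 F ξ) := by
    intro y
    refine (𝓕 F).integrable.bdd_mul (c := 1) (by fun_prop) (ae_of_all _ fun ξ => ?_)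
    rw [Complex.norm_exp_ofReal_mul_I]
  rw [key x, key (x + h), key (x - h), ← integral_const_mul, ← integral_sub, ← integral_sub]
  · congr 1
    ext ξ
    have h2 : (diffSymbol h ξ : ℂ) = 2 -
        (Complex.exp (((2 * Real.pi * inner ℝ ξ h : ℝ) : ℂ) * Complex.I) +
        Complex.exp (-((2 * Real.pi * inner ℝ ξ h : ℝ) : ℂ) * Complex.I)) := by
      rw [← Complex.two_cos, ← Complex.ofReal_cos, diffSymbol, real_inner_comm]
      push_cast
      rfl
    rw [h2, inner_add_right, inner_sub_right]
    have h3 : ((2 * Real.pi * (inner ℝ ξ x + inner ℝ ξ h) : ℝ) : ℂ) * Complex.I =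
      ((2 * Real.pi * inner ℝ ξ x : ℝ) : ℂ) * Complex.I +
      ((2 * Real.pi * inner ℝ ξ h : ℝ) : ℂ) * Complex.I := by push_cast; ring
    have h4 : ((2 * Real.pi * (inner ℝ ξ x - inner ℝ ξ h) : ℝ) : ℂ) * Complex.I =
      ((2 * Real.pi * inner ℝ ξ x : ℝ) : ℂ) * Complex.I +
      -((2 * Real.pi * inner ℝ ξ h : ℝ) : ℂ) * Complex.I := by push_cast; ring
    rw [h3, h4, Complex.exp_add, Complex.exp_add]
    ring
  · exact ((hint x).const_mul 2).sub (hint _)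
  · exact hint _
  · exact (hint x).const_mul 2
  · exact hint _

/-- Justifies Fubini in frequency and increment. By the Lévy–Khintchine formula, integrating the
norm over `h` gives `c ‖ξ‖^(2s) ‖G ξ‖`, which is integrable since `G` is Schwartz. The unimodular
`e` stands for the phase of the inverse transform. -/
theorem integrable_levyKernel_mul_diffSymbol {d : ℕ} (hd : 1 ≤ d) {s : ℝ} (hs : 1 / 2 ≤ s)
    (hs1 : s < 1) {e : RSpace d → ℂ} (hec : Continuous e) (hen : ∀ ξ, ‖e ξ‖ = 1)
    (G : SchwartzMap (RSpace d) ℂ) :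
    Integrable (fun p : RSpace d × RSpace d =>
      (levyKernel d s p.2 : ℂ) * (e p.1 * ((diffSymbol p.2 p.1 : ℂ) * G p.1)))
      (volume.prod volume) := by
  obtain ⟨c, -, hcξ⟩ := exists_integral_diffSymbol_eq hd hs hs1
  have hm : AEStronglyMeasurable (fun p : RSpace d × RSpace d =>
      (levyKernel d s p.2 : ℂ) * (e p.1 * ((diffSymbol p.2 p.1 : ℂ) * G p.1)))
      (volume.prod volume) := by
    have h1 : Measurable (fun p : RSpace d × RSpace d => (levyKernel d s p.2 : ℂ)) :=
      Complex.measurable_ofReal.comp ((measurable_levyKernel d s).comp measurable_snd)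
    have h2 : Continuous (fun p : RSpace d × RSpace d => (diffSymbol p.2 p.1 : ℂ)) :=
      by unfold diffSymbol; fun_prop
    have h3 : Continuous (fun p : RSpace d × RSpace d => e p.1) := hec.comp continuous_fst
    have h4 : Continuous (fun p : RSpace d × RSpace d => G p.1) :=
      G.continuous.comp continuous_fst
    have h5 : Continuous (fun p : RSpace d × RSpace d => e p.1 * ((diffSymbol p.2 p.1 : ℂ) * G p.1)) :=
      h3.mul (h2.mul h4)
    exact h1.aestronglyMeasurable.mul h5.aestronglyMeasurable
  have hn : ∀ ξ h : RSpace d, ‖(levyKernel d s h : ℂ) * (e ξ * ((diffSymbol h ξ : ℂ) * G ξ))‖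
      = diffSymbol h ξ * levyKernel d s h * ‖G ξ‖ := by
    intro ξ h
    rw [norm_mul, norm_mul, norm_mul, hen, Complex.norm_real, Complex.norm_real,
      Real.norm_of_nonneg (diffSymbol_nonneg _ _), Real.norm_of_nonneg (levyKernel_nonneg _ _ _)]
    ring
  rw [integrable_prod_iff hm]
  constructor
  · refine ae_of_all _ fun ξ => ?_
    have h1 : Integrable (fun h : RSpace d =>
        ((diffSymbol h ξ * levyKernel d s h : ℝ) : ℂ) * (e ξ * G ξ)) :=
      ((integrable_diffSymbol_mul_levyKernel hd hs hs1 ξ).ofReal).mul_const _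
    refine h1.congr (ae_of_all _ fun h => ?_)
    push_cast
    ring
  · simp_rw [hn, integral_mul_const, hcξ]
    refine ((integrable_fracSymbol_mul_norm (by linarith) hs1.le G).const_mul
      (c / (2 * Real.pi) ^ (2 * s))).congr (ae_of_all _ fun ξ => ?_)
    simp only [fracSymbol]
    rw [Real.mul_rpow (by positivity) (norm_nonneg _)]
    have : (2 * Real.pi) ^ (2 * s) ≠ 0 := (Real.rpow_pos_of_pos Real.two_pi_pos _).ne'
    field_simp

/-- The singular integral representation of the fractional Laplacian. -/
theorem exists_fracLaplacianC_eq_integral {d : ℕ} (hd : 1 ≤ d) {s : ℝ} (hs : 1 / 2 ≤ s)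
    (hs1 : s < 1) : ∃ c : ℂ, ∀ (F : SchwartzMap (RSpace d) ℂ) (x : RSpace d),
      fracLaplacianC s (F : RSpace d → ℂ) x =
        c * ∫ h, (levyKernel d s h : ℂ) * (2 * F x - F (x + h) - F (x - h)) := by
  obtain ⟨c, hc, hcξ⟩ := exists_integral_diffSymbol_eq hd hs hs1
  refine ⟨(((2 * Real.pi) ^ (2 * s) / c : ℝ) : ℂ), fun F x => ?_⟩
  set e : RSpace d → ℂ := fun ξ => Complex.exp (((2 * Real.pi * inner ℝ ξ x : ℝ) : ℂ) * Complex.I)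
    with he
  have hen : ∀ ξ, ‖e ξ‖ = 1 := fun ξ => Complex.norm_exp_ofReal_mul_I _
  have hec : Continuous e := by rw [he]; fun_prop
  have hint := integrable_levyKernel_mul_diffSymbol hd hs hs1 hec hen (𝓕 F)
  have h0 : ∫ h, (levyKernel d s h : ℂ) * (2 * F x - F (x + h) - F (x - h)) =
      ∫ ξ, ∫ h, (levyKernel d s h : ℂ) * (e ξ * ((diffSymbol h ξ : ℂ) * 𝓕 F ξ)) := by
    rw [integral_integral_swap hint]
    refine integral_congr_ae (ae_of_all _ fun h => ?_)
    simp only [secondDifference_eq_integral]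
    rw [← integral_const_mul]
  unfold fracLaplacianC
  rw [h0, Real.fourierInv_eq', ← integral_const_mul]
  refine integral_congr_ae (ae_of_all _ fun ξ => ?_)
  simp only
  have h1 : ∫ h : RSpace d, (levyKernel d s h : ℂ) * (e ξ * ((diffSymbol h ξ : ℂ) * 𝓕 F ξ)) =
      ((c * ‖ξ‖ ^ (2 * s) : ℝ) : ℂ) * (e ξ * 𝓕 F ξ) := by
    rw [← hcξ, ← integral_complex_ofReal, ← integral_mul_const]
    congr 1
    ext h
    push_cast
    ring
  rw [h1]
  simp only [fracSymbol, smul_eq_mul, SchwartzMap.fourier_coe]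
  rw [Real.mul_rpow (by positivity) (norm_nonneg _)]
  push_cast
  have : (c : ℂ) ≠ 0 := by exact_mod_cast hc.ne'
  field_simp
  rw [he]
  push_cast
  ring

/-- The second difference is, up to sign, an increment of `y ↦ f (y + h) - f y` between `x - h` and
`x`. Its derivative is at most `K ‖h‖`, where `K` is a Lipschitz constant of `fderiv ℝ f`. -/
theorem exists_norm_secondDifference_le {E F : Type*} [NormedAddCommGroup E] [NormedSpace ℝ E]
    [NormedAddCommGroup F] [NormedSpace ℝ F] {f : E → F} (hf : ContDiff ℝ 2 f)
    (hc : HasCompactSupport f) :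
    ∃ M : ℝ, 0 ≤ M ∧ ∀ x h : E, ‖(2 : ℝ) • f x - f (x + h) - f (x - h)‖ ≤ M * ‖h‖ ^ 2 := by
  have hf' : ContDiff ℝ 1 (fderiv ℝ f) := hf.fderiv_right (by norm_num)
  obtain ⟨K, hK⟩ := hf'.lipschitzWith_of_hasCompactSupport (hc.fderiv ℝ) one_ne_zero
  refine ⟨K, K.2, fun x h => ?_⟩
  have hd : Differentiable ℝ f := hf.differentiable (by norm_num)
  have hg : ∀ y, HasFDerivAt (fun y => f (y + h) - f y) (fderiv ℝ f (y + h) - fderiv ℝ f y) y :=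
    fun y => ((hasFDerivAt_comp_add_right (𝕜 := ℝ) h).2 (hd (y + h)).hasFDerivAt).sub (hd y).hasFDerivAt
  have hb : ∀ y, ‖fderiv ℝ (fun y => f (y + h) - f y) y‖ ≤ K * ‖h‖ := by
    intro y
    rw [(hg y).fderiv]
    simpa [dist_eq_norm] using hK.dist_le_mul (y + h) y
  have := convex_univ.norm_image_sub_le_of_norm_fderiv_le (𝕜 := ℝ)
    (f := fun y => f (y + h) - f y) (fun y _ => (hg y).differentiableAt)
    (fun y _ => hb y) (mem_univ x) (mem_univ (x - h))
  simp only [sub_add_cancel, sub_sub_cancel_left, norm_neg] at this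
  calc _ = ‖f x - f (x - h) - (f (x + h) - f x)‖ := by
        congr 1
        rw [two_smul]
        abel
    _ ≤ _ := this
    _ = _ := by ring

theorem integrable_secondDifference {d : ℕ} {F : RSpace d → ℂ} (hf : Integrable F)
    (h : RSpace d) : Integrable (fun x => 2 * F x - F (x + h) - F (x - h)) :=
  ((hf.const_mul 2).sub (hf.comp_add_right h)).sub (hf.comp_sub_right h)

theorem integral_add_translates {d : ℕ} {f : RSpace d → ℝ} (hf : Integrable f) (a : ℝ)
    (h : RSpace d) : ∫ x, (a * f x + f (x + h) + f (x - h)) = (a + 2) * ∫ x, f x := by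
  have h1 : Integrable (fun x => a * f x + f (x + h)) :=
    (hf.const_mul a).add (hf.comp_add_right h)
  rw [integral_add h1 (hf.comp_sub_right h), integral_add (hf.const_mul a) (hf.comp_add_right h),
    integral_const_mul, integral_add_right_eq_self f, integral_sub_right_eq_self f]
  ring

/-- For large `h` translation invariance gives four times the `L¹` norm. For small `h` the pointwise
quadratic bound is integrated over three translates of the support. -/
theorem exists_integral_norm_secondDifference_le {d : ℕ} {F : RSpace d → ℂ} (hf : ContDiff ℝ 2 F)
    (hc : HasCompactSupport F) :
    ∃ M : ℝ, ∀ h : RSpace d, ∫ x, ‖2 * F x - F (x + h) - F (x - h)‖ ≤ M * min 1 (‖h‖ ^ 2) := by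
  obtain ⟨M, hM, hMb⟩ := exists_norm_secondDifference_le hf hc
  have hF : Integrable F := hf.continuous.integrable_of_hasCompactSupport hc
  set K := tsupport F with hK
  have hKc : IsCompact K := hc
  set ι : RSpace d → ℝ := K.indicator 1 with hι
  have hιi : Integrable ι := (integrable_indicator_iff hKc.measurableSet).2
    (integrableOn_const hKc.measure_lt_top.ne)
  have hι0 : ∀ x, 0 ≤ ι x := fun x => indicator_nonneg (fun _ _ => zero_le_one) x
  have hι1 : ∀ x, F x ≠ 0 → ι x = 1 := fun x hx => by
    rw [hι, indicator_of_mem (subset_tsupport F hx)]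
    rfl
  refine ⟨max (4 * ∫ x, ‖F x‖) (3 * M * ∫ x, ι x), fun h => ?_⟩
  have h1 : ∫ x, ‖2 * F x - F (x + h) - F (x - h)‖ ≤ 4 * ∫ x, ‖F x‖ := by
    calc _ ≤ ∫ x, (2 * ‖F x‖ + ‖F (x + h)‖ + ‖F (x - h)‖) := by
          refine integral_mono (integrable_secondDifference hF h).norm
            (((hF.norm.const_mul 2).add (hF.comp_add_right h).norm).add
              (hF.comp_sub_right h).norm) fun x => ?_
          refine (norm_sub_le _ _).trans (add_le_add_left ((norm_sub_le _ _).trans ?_) _)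
          simp
      _ = _ := by
          rw [integral_add_translates hF.norm]
          ring
  have h2 : ∫ x, ‖2 * F x - F (x + h) - F (x - h)‖ ≤ 3 * M * (∫ x, ι x) * ‖h‖ ^ 2 := by
    calc _ ≤ ∫ x, (M * ‖h‖ ^ 2) * (ι x + ι (x + h) + ι (x - h)) := by
          refine integral_mono (integrable_secondDifference hF h).norm
            (((hιi.add (hιi.comp_add_right h)).add
              (hιi.comp_sub_right h)).const_mul _) fun x => ?_
          by_cases h0 : F x = 0 ∧ F (x + h) = 0 ∧ F (x - h) = 0
          · simp only [h0.1, h0.2.1, h0.2.2]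
            simp only [mul_zero, sub_self, norm_zero]
            have := hι0 x
            have := hι0 (x + h)
            have := hι0 (x - h)
            positivity
          · have h3 : 1 ≤ ι x + ι (x + h) + ι (x - h) := by
              have a1 := hι0 x
              have a2 := hι0 (x + h)
              have a3 := hι0 (x - h)
              by_cases b1 : F x = 0
              · by_cases b2 : F (x + h) = 0
                · have := hι1 (x - h) fun b3 => h0 ⟨b1, b2, b3⟩
                  linarith
                · have := hι1 _ b2
                  linarith
              · have := hι1 _ b1
                linarith
            have h4 := hMb x h
            simp only [Complex.real_smul, Complex.ofReal_ofNat] at h4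
            exact h4.trans (le_mul_of_one_le_right (by positivity) h3)
      _ = _ := by
          have := integral_add_translates hιi 1 h
          simp only [one_mul] at this
          rw [integral_const_mul, this]
          ring
  rcases le_total (‖h‖ ^ 2) 1 with h5 | h5
  · rw [min_eq_right h5]
    exact h2.trans (mul_le_mul_of_nonneg_right (le_max_right _ _) (by positivity))
  · rw [min_eq_left h5, mul_one]
    exact h1.trans (le_max_left _ _)

/-- The fractional Laplacian of a test function is integrable. -/
theorem integrable_fracLaplacianC {d : ℕ} (hd : 1 ≤ d) {s : ℝ} (hs : s ∈ Icc (1 / 2 : ℝ) 1)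
    (F : SchwartzMap (RSpace d) ℂ) (hF : HasCompactSupport F) :
    Integrable (fracLaplacianC s (F : RSpace d → ℂ)) := by
  rcases hs.2.eq_or_lt with rfl | hs1
  · exact integrable_fracLaplacianC_one F
  obtain ⟨c, hc⟩ := exists_fracLaplacianC_eq_integral hd hs.1 hs1
  obtain ⟨M, hM⟩ := exists_integral_norm_secondDifference_le (F.smooth 2) hF
  have h1 : fracLaplacianC s (F : RSpace d → ℂ) = fun x =>
      c * ∫ h, (levyKernel d s h : ℂ) * (2 * F x - F (x + h) - F (x - h)) := funext (hc F)
  rw [h1]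
  refine Integrable.const_mul ?_ c
  have hm : AEStronglyMeasurable (fun p : RSpace d × RSpace d =>
      (levyKernel d s p.2 : ℂ) * (2 * F p.1 - F (p.1 + p.2) - F (p.1 - p.2)))
      (volume.prod volume) := by
    have m1 : Measurable (fun p : RSpace d × RSpace d => (levyKernel d s p.2 : ℂ)) :=
      Complex.measurable_ofReal.comp ((measurable_levyKernel d s).comp measurable_snd)
    have m2 : Continuous (fun p : RSpace d × RSpace d =>
        2 * F p.1 - F (p.1 + p.2) - F (p.1 - p.2)) := by
      have := F.continuous
      fun_prop
    exact m1.aestronglyMeasurable.mul m2.aestronglyMeasurable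
  -- Joint integrability is checked by integrating in `x` first: the `L¹` bound on second
  -- differences compensates the singularity of the kernel at `h = 0`.
  refine Integrable.integral_prod_left (f := fun p : RSpace d × RSpace d =>
      (levyKernel d s p.2 : ℂ) * (2 * F p.1 - F (p.1 + p.2) - F (p.1 - p.2)))
      ((integrable_prod_iff' hm).2 ⟨ae_of_all _ fun h => ?_, ?_⟩)
  · exact (integrable_secondDifference F.integrable h).const_mul (levyKernel d s h : ℂ)
  · refine ((integrable_min_mul_levyKernel hd hs.1 hs1).const_mul M).mono'
      (hm.norm.prod_swap.integral_prod_right') (ae_of_all _ fun h => ?_)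
    rw [Real.norm_of_nonneg (integral_nonneg fun _ => norm_nonneg _)]
    simp only [norm_mul, Complex.norm_real, Real.norm_of_nonneg (levyKernel_nonneg _ _ _)]
    rw [integral_const_mul, mul_comm, ← mul_assoc]
    exact mul_le_mul_of_nonneg_right (hM h) (levyKernel_nonneg _ _ _)

/-- The Schwartz function defined by a real test function. -/
theorem exists_schwartzMap_eq {d : ℕ} {f : RSpace d → ℝ} (hf : ContDiff ℝ ∞ f)
    (hc : HasCompactSupport f) : ∃ F : SchwartzMap (RSpace d) ℂ, HasCompactSupport F ∧
      (F : RSpace d → ℂ) = fun x => (f x : ℂ) := by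
  have h1 : HasCompactSupport (fun x => (f x : ℂ)) := hc.comp_left (g := Complex.ofReal) rfl
  have h2 : ContDiff ℝ ∞ (fun x => (f x : ℂ)) := Complex.ofRealCLM.contDiff.comp hf
  exact ⟨h1.toSchwartzMap h2, h1, rfl⟩

theorem integrable_fracLaplacian {d : ℕ} (hd : 1 ≤ d) {s : ℝ} (hs : s ∈ Icc (1 / 2 : ℝ) 1)
    {f : RSpace d → ℝ} (hf : ContDiff ℝ ∞ f) (hc : HasCompactSupport f) :
    Integrable (fracLaplacian s f) := by
  obtain ⟨F, hF, hFf⟩ := exists_schwartzMap_eq hf hc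
  have := (integrable_fracLaplacianC hd hs F hF).re
  rw [hFf] at this
  exact this

/-! ### Plane waves as limits of test functions. -/

/-- The phase `x ↦ -2πi⟪x, ξ⟫` as a real-linear map. -/
noncomputable def planePhase {d : ℕ} (ξ : RSpace d) : RSpace d →L[ℝ] ℂ :=
  ((-2 * Real.pi * Complex.I : ℂ)) • (Complex.ofRealCLM ∘L innerSL ℝ ξ)

theorem planePhase_apply {d : ℕ} (ξ x : RSpace d) :
    planePhase ξ x = ((-2 * Real.pi * inner ℝ x ξ : ℝ) : ℂ) * Complex.I := by
  simp only [planePhase, smul_apply, ContinuousLinearMap.comp_apply,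
    innerSL_apply_apply, Complex.ofRealCLM_apply, smul_eq_mul, real_inner_comm]
  push_cast
  ring

/-- The plane wave `exp (-2πi⟪x, ξ⟫)`. -/
noncomputable def planeWave {d : ℕ} (ξ x : RSpace d) : ℂ := Complex.exp (planePhase ξ x)

theorem norm_planeWave {d : ℕ} (ξ x : RSpace d) : ‖planeWave ξ x‖ = 1 := by
  rw [planeWave, planePhase_apply, Complex.norm_exp_ofReal_mul_I]

theorem contDiff_planeWave {d : ℕ} (ξ : RSpace d) : ContDiff ℝ ∞ (planeWave ξ) :=
  (planePhase ξ).contDiff.cexp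

theorem planeWave_add_left {d : ℕ} (ξ η x : RSpace d) :
    planeWave (ξ + η) x = planeWave ξ x * planeWave η x := by
  rw [planeWave, planeWave, planeWave, ← Complex.exp_add]
  congr 1
  simp only [planePhase_apply, inner_add_right]
  push_cast
  ring

theorem planeWave_neg_left {d : ℕ} (ξ x : RSpace d) :
    planeWave (-ξ) x = (starRingEnd ℂ) (planeWave ξ x) := by
  rw [planeWave, planeWave, ← Complex.exp_conj]
  congr 1
  simp only [planePhase_apply, inner_neg_right, map_mul, Complex.conj_ofReal, Complex.conj_I]
  push_cast
  ring

theorem fourier_eq_integral_planeWave {d : ℕ} (f : RSpace d → ℂ) (ξ : RSpace d) :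
    𝓕 f ξ = ∫ x, planeWave ξ x * f x := by
  rw [Real.fourier_eq']
  simp only [planeWave, planePhase_apply, smul_eq_mul]

theorem fourierInv_eq_integral_planeWave {d : ℕ} (f : RSpace d → ℂ) (x : RSpace d) :
    𝓕⁻ f x = ∫ ξ, planeWave (-ξ) x * f ξ := by
  rw [Real.fourierInv_eq']
  simp only [planeWave, planePhase_apply, smul_eq_mul, inner_neg_right]
  refine integral_congr_ae (ae_of_all _ fun ξ => ?_)
  simp only
  rw [real_inner_comm]
  congr 3
  push_cast
  ring

theorem fourier_planeWave_mul_dilation {d : ℕ} (F : RSpace d → ℂ) {R : ℝ} (hR : 0 < R)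
    (ξ η : RSpace d) :
    𝓕 (fun x => planeWave ξ x * F (R⁻¹ • x)) η = (R ^ d : ℝ) * 𝓕 F (R • (η + ξ)) := by
  rw [fourier_eq_integral_planeWave, fourier_eq_integral_planeWave]
  obtain ⟨G, hG⟩ : ∃ G : RSpace d → ℂ, G = fun y => planeWave (R • (η + ξ)) y * F y := ⟨_, rfl⟩
  have h1 : ∀ x, planeWave η x * (planeWave ξ x * F (R⁻¹ • x)) = G (R⁻¹ • x) := by
    intro x
    have : planeWave (R • (η + ξ)) (R⁻¹ • x) = planeWave (η + ξ) x := by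
      rw [planeWave, planeWave]
      congr 1
      simp only [planePhase_apply, inner_smul_left, inner_smul_right]
      congr 2
      simp only [conj_trivial]
      field_simp
    simp only [hG, this, planeWave_add_left]
    ring
  simp_rw [h1]
  rw [Measure.integral_comp_inv_smul, finrank_euclideanSpace_fin, abs_of_pos (by positivity),
    Complex.real_smul, hG]

/-- The substitution `ζ = R (η + ξ)` moves the dilation from the function to the symbol and the
phase. Both a bound uniform in `R ≥ 1` and the limit `R → ∞` can then be read off the integrand. -/
theorem fracLaplacianC_planeWave_mul_dilation {d : ℕ} (s : ℝ) (F : RSpace d → ℂ) {R : ℝ}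
    (hR : 0 < R) (ξ x : RSpace d) :
    fracLaplacianC s (fun x => planeWave ξ x * F (R⁻¹ • x)) x =
      ∫ ζ, planeWave (ξ - R⁻¹ • ζ) x * ((fracSymbol s (R⁻¹ • ζ - ξ) : ℂ) * 𝓕 F ζ) := by
  rw [fracLaplacianC, fourierInv_eq_integral_planeWave]
  obtain ⟨G, hG⟩ : ∃ G : RSpace d → ℂ, G = fun ζ => planeWave (ξ - R⁻¹ • ζ) x *
    ((fracSymbol s (R⁻¹ • ζ - ξ) : ℂ) * 𝓕 F ζ) := ⟨_, rfl⟩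
  have h1 : ∀ η, planeWave (-η) x * ((fracSymbol s η : ℂ) *
      𝓕 (fun x => planeWave ξ x * F (R⁻¹ • x)) η) = (R ^ d : ℝ) * G (R • (η + ξ)) := by
    intro η
    rw [fourier_planeWave_mul_dilation F hR]
    simp only [hG, smul_smul, inv_mul_cancel₀ hR.ne', one_smul, add_sub_cancel_right,
      sub_add_cancel_right]
    ring
  simp_rw [h1]
  rw [integral_const_mul, integral_add_right_eq_self (fun η => G (R • η)),
    Measure.integral_comp_smul, finrank_euclideanSpace_fin, abs_of_pos (by positivity),
    Complex.real_smul, ← mul_assoc, ← Complex.ofReal_mul, mul_inv_cancel₀ (by positivity), hG]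
  simp

theorem fracSymbol_sub_le {d : ℕ} {s : ℝ} (hs : 0 ≤ s) (hs1 : s ≤ 1) (η ξ : RSpace d) :
    fracSymbol s (η - ξ) ≤ (1 + 2 * (2 * Real.pi * ‖ξ‖) ^ 2) + 2 * (2 * Real.pi) ^ 2 * ‖η‖ ^ 2 := by
  refine (rpow_two_mul_le (by positivity : 0 ≤ 2 * Real.pi * ‖η - ξ‖) hs hs1).trans ?_
  have h1 : ‖η - ξ‖ ^ 2 ≤ 2 * ‖η‖ ^ 2 + 2 * ‖ξ‖ ^ 2 := by
    have h2 := norm_sub_le η ξ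
    nlinarith [norm_nonneg (η - ξ), sq_nonneg (‖η‖ - ‖ξ‖)]
  have := mul_le_mul_of_nonneg_left h1 (by positivity : 0 ≤ (2 * Real.pi) ^ 2)
  rw [mul_pow, mul_pow]
  linarith

/-- The dominating function for `fracLaplacianC_planeWave_mul_dilation`. -/
noncomputable def dilationBound {d : ℕ} (F : SchwartzMap (RSpace d) ℂ) (ξ ζ : RSpace d) : ℝ :=
  ((1 + 2 * (2 * Real.pi * ‖ξ‖) ^ 2) + 2 * (2 * Real.pi) ^ 2 * ‖ζ‖ ^ 2) * ‖𝓕 F ζ‖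

theorem integrable_dilationBound {d : ℕ} (F : SchwartzMap (RSpace d) ℂ) (ξ : RSpace d) :
    Integrable (dilationBound F ξ) := by
  refine (((𝓕 F).integrable.norm.const_mul (1 + 2 * (2 * Real.pi * ‖ξ‖) ^ 2)).add
    (((𝓕 F).integrable_pow_mul volume 2).const_mul (2 * (2 * Real.pi) ^ 2))).congr
    (ae_of_all _ fun ζ => ?_)
  simp only [dilationBound, Pi.add_apply]
  ring

theorem norm_dilation_integrand_le {d : ℕ} {s : ℝ} (hs : 0 ≤ s) (hs1 : s ≤ 1)
    (F : SchwartzMap (RSpace d) ℂ) {R : ℝ} (hR : 1 ≤ R) (ξ x ζ : RSpace d) :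
    ‖planeWave (ξ - R⁻¹ • ζ) x * ((fracSymbol s (R⁻¹ • ζ - ξ) : ℂ) * 𝓕 F ζ)‖ ≤
      dilationBound F ξ ζ := by
  rw [norm_mul, norm_mul, norm_planeWave, one_mul, Complex.norm_real,
    Real.norm_of_nonneg (fracSymbol_nonneg _ _), dilationBound]
  refine mul_le_mul_of_nonneg_right ((fracSymbol_sub_le hs hs1 _ _).trans ?_) (norm_nonneg _)
  have h1 : ‖R⁻¹ • ζ‖ ≤ ‖ζ‖ := by
    rw [norm_smul, Real.norm_of_nonneg (by positivity)]
    exact mul_le_of_le_one_left (norm_nonneg _) (inv_le_one_of_one_le₀ hR)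
  gcongr

theorem norm_fracLaplacianC_planeWave_le {d : ℕ} {s : ℝ} (hs : 0 ≤ s) (hs1 : s ≤ 1)
    (F : SchwartzMap (RSpace d) ℂ) {R : ℝ} (hR : 1 ≤ R) (ξ x : RSpace d) :
    ‖fracLaplacianC s (fun x => planeWave ξ x * F (R⁻¹ • x)) x‖ ≤
      ∫ ζ, dilationBound F ξ ζ := by
  rw [fracLaplacianC_planeWave_mul_dilation s F (by linarith)]
  refine norm_integral_le_of_norm_le (integrable_dilationBound F ξ) (ae_of_all _ fun ζ => ?_)
  exact norm_dilation_integrand_le hs hs1 F hR ξ x ζ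

theorem tendsto_fracLaplacianC_planeWave {d : ℕ} {s : ℝ} (hs : 0 ≤ s) (hs1 : s ≤ 1)
    (F : SchwartzMap (RSpace d) ℂ) {R : ℕ → ℝ} (hR : ∀ n, 1 ≤ R n)
    (hRt : Tendsto (fun n => (R n)⁻¹) atTop (𝓝 0)) (ξ x : RSpace d) :
    Tendsto (fun n => fracLaplacianC s (fun x => planeWave ξ x * F ((R n)⁻¹ • x)) x) atTop
      (𝓝 (planeWave ξ x * ((fracSymbol s ξ : ℂ) * F 0))) := by
  -- The limit is the same integral with `R⁻¹` replaced by `0`, since Fourier inversion at the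
  -- origin gives `F 0 = ∫ 𝓕 F`.
  have h0 : planeWave ξ x * ((fracSymbol s ξ : ℂ) * F 0) =
      ∫ ζ, planeWave (ξ - (0 : ℝ) • ζ) x * ((fracSymbol s ((0 : ℝ) • ζ - ξ) : ℂ) * 𝓕 F ζ) := by
    have h1 : F 0 = ∫ ζ, 𝓕 F ζ := by
      conv_lhs => rw [← FourierTransform.fourierInv_fourier_eq (F := SchwartzMap (RSpace d) ℂ) F,
        SchwartzMap.fourierInv_coe, Real.fourierInv_eq']
      simp
    simp only [zero_smul, sub_zero, zero_sub]
    rw [integral_const_mul, integral_const_mul, h1]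
    simp [fracSymbol]
  rw [h0]
  have hq := continuous_fracSymbol d hs
  simp_rw [fun n => fracLaplacianC_planeWave_mul_dilation s F
    (zero_lt_one.trans_le (hR n)) ξ x]
  have hpw : Continuous fun η : RSpace d => planeWave η x := by
    simp only [planeWave, planePhase_apply]
    fun_prop
  refine tendsto_integral_of_dominated_convergence (dilationBound F ξ) (fun n => ?_)
    (integrable_dilationBound F ξ) (fun n => ae_of_all _ fun ζ => ?_) (ae_of_all _ fun ζ => ?_)
  · refine Continuous.aestronglyMeasurable ?_
    have h1 : Continuous fun ζ => planeWave (ξ - (R n)⁻¹ • ζ) x := hpw.comp (by fun_prop)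
    have h2 : Continuous fun ζ => (fracSymbol s ((R n)⁻¹ • ζ - ξ) : ℂ) :=
      Complex.continuous_ofReal.comp (hq.comp (by fun_prop))
    have h3 : Continuous (𝓕 (F : RSpace d → ℂ)) := by
      rw [← SchwartzMap.fourier_coe]
      exact (𝓕 F).continuous
    exact h1.mul (h2.mul h3)
  · exact norm_dilation_integrand_le hs hs1 F (hR n) ξ x ζ
  · have h1 : Tendsto (fun n => (R n)⁻¹ • ζ) atTop (𝓝 ((0 : ℝ) • ζ)) := hRt.smul_const ζ
    have h2 : Tendsto (fun n => planeWave (ξ - (R n)⁻¹ • ζ) x) atTop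
        (𝓝 (planeWave (ξ - (0 : ℝ) • ζ) x)) := (hpw.tendsto _).comp (h1.const_sub ξ)
    have h3 : Tendsto (fun n => fracSymbol s ((R n)⁻¹ • ζ - ξ)) atTop
        (𝓝 (fracSymbol s ((0 : ℝ) • ζ - ξ))) := (hq.tendsto _).comp (h1.sub_const ξ)
    exact h2.mul (h3.ofReal.mul_const _)

theorem fracLaplacianC_linear {d : ℕ} {s : ℝ} (hs : 0 ≤ s) (hs1 : s ≤ 1)
    (F G : SchwartzMap (RSpace d) ℂ) (a b : ℂ) (x : RSpace d) :
    fracLaplacianC s (fun x => a * F x + b * G x) x =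
      a * fracLaplacianC s (F : RSpace d → ℂ) x + b * fracLaplacianC s (G : RSpace d → ℂ) x := by
  have hpw : Continuous fun η : RSpace d => planeWave (-η) x := by
    simp only [planeWave, planePhase_apply]
    fun_prop
  have h1 : ∀ H : SchwartzMap (RSpace d) ℂ,
      Integrable (fun η => planeWave (-η) x * ((fracSymbol s η : ℂ) * 𝓕 (H : RSpace d → ℂ) η)) := by
    intro H
    have hc : Continuous (𝓕 (H : RSpace d → ℂ)) := by
      rw [← SchwartzMap.fourier_coe]
      exact (𝓕 H).continuous
    refine (integrable_fracSymbol_mul_norm hs hs1 (𝓕 H)).mono' (hpw.mul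
      ((Complex.continuous_ofReal.comp (continuous_fracSymbol d hs)).mul hc)).aestronglyMeasurable
      (ae_of_all _ fun η => ?_)
    rw [norm_mul, norm_mul, norm_planeWave, one_mul, Complex.norm_real,
      Real.norm_of_nonneg (fracSymbol_nonneg _ _)]
    rfl
  have h2 : 𝓕 (fun x => a * F x + b * G x) =
      fun η => a * 𝓕 (F : RSpace d → ℂ) η + b * 𝓕 (G : RSpace d → ℂ) η := by
    have := SchwartzMap.fourier_coe (a • F + b • G)
    rw [FourierTransform.fourier_add, FourierTransform.fourier_smul,
      FourierTransform.fourier_smul] at this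
    exact this.symm
  simp only [fracLaplacianC]
  rw [fourierInv_eq_integral_planeWave, fourierInv_eq_integral_planeWave,
    fourierInv_eq_integral_planeWave, ← integral_const_mul, ← integral_const_mul,
    ← integral_add ((h1 F).const_mul a) ((h1 G).const_mul b), h2]
  refine integral_congr_ae (ae_of_all _ fun η => ?_)
  simp only
  ring

theorem exists_schwartzMap_planeWave_mul_dilation {d : ℕ} (F : SchwartzMap (RSpace d) ℂ)
    (hF : HasCompactSupport F) {R : ℝ} (hR : 0 < R) (ξ : RSpace d) :
    ∃ G : SchwartzMap (RSpace d) ℂ, (G : RSpace d → ℂ) = fun x => planeWave ξ x * F (R⁻¹ • x) := by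
  have h1 : HasCompactSupport (fun x => F (R⁻¹ • x)) := hF.comp_smul (inv_ne_zero hR.ne')
  have h2 : HasCompactSupport (fun x => planeWave ξ x * F (R⁻¹ • x)) := h1.mul_left
  have h3 : ContDiff ℝ ∞ (fun x => planeWave ξ x * F (R⁻¹ • x)) :=
    (contDiff_planeWave ξ).mul ((F.smooth ⊤).comp (contDiff_const_smul _))
  exact ⟨h2.toSchwartzMap h3, rfl⟩

/-- Plane waves are limits of test functions, with uniform control of the fractional Laplacian
and of the gradient. -/
theorem exists_testFunction_tendsto_planeWave {d : ℕ} {s : ℝ} (hs : 0 ≤ s) (hs1 : s ≤ 1)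
    (ξ : RSpace d) (c : ℂ) :
    ∃ (f : ℕ → RSpace d → ℝ) (M : ℝ),
      (∀ n, ContDiff ℝ ∞ (f n) ∧ HasCompactSupport (f n)) ∧
      (∀ n x, |f n x| ≤ M ∧ |fracLaplacian s (f n) x| ≤ M ∧ ‖fderiv ℝ (f n) x‖ ≤ M) ∧
      ∀ x, Tendsto (fun n => f n x) atTop (𝓝 (c * planeWave ξ x).re) ∧
        Tendsto (fun n => fracLaplacian s (f n) x) atTop
          (𝓝 (c * (fracSymbol s ξ * planeWave ξ x)).re) ∧
        ∀ v, Tendsto (fun n => fderiv ℝ (f n) x v) atTop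
          (𝓝 (c * (planePhase ξ v * planeWave ξ x)).re) := by
  let χ : ContDiffBump (0 : RSpace d) := ⟨1, 2, one_pos, one_lt_two⟩
  have hχ : ContDiff ℝ ∞ χ := χ.contDiff
  have hχc : HasCompactSupport χ := χ.hasCompactSupport
  have hχ1 : ∀ x, |χ x| ≤ 1 := fun x => by
    rw [abs_of_nonneg χ.nonneg]
    exact χ.le_one
  have hχ0 : χ 0 = 1 := χ.one_of_mem_closedBall (by simp [χ])
  obtain ⟨F, hF, hFχ⟩ := exists_schwartzMap_eq hχ hχc
  have hF0 : F 0 = 1 := by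
    rw [hFχ]
    simp [hχ0]
  obtain ⟨B, hB⟩ : ∃ B, ∀ x, ‖fderiv ℝ χ x‖ ≤ B :=
    (hχc.fderiv ℝ).exists_bound_of_continuous (hχ.continuous_fderiv (by simp))
  have hB0 : 0 ≤ B := (norm_nonneg _).trans (hB 0)
  set R : ℕ → ℝ := fun n => n + 1 with hRdef
  have hR : ∀ n, 1 ≤ R n := fun n => by simp [hRdef]
  have hR0 : ∀ n, 0 < R n := fun n => zero_lt_one.trans_le (hR n)
  have hRi : ∀ n, (R n)⁻¹ ≤ 1 := fun n => inv_le_one_of_one_le₀ (hR n)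
  have hRt : Tendsto (fun n => (R n)⁻¹) atTop (𝓝 0) :=
    (tendsto_natCast_atTop_atTop.atTop_add tendsto_const_nhds).inv_tendsto_atTop
  have hRx : ∀ x : RSpace d, Tendsto (fun n => (R n)⁻¹ • x) atTop (𝓝 0) := fun x => by
    simpa using hRt.smul_const x
  have hχt : ∀ x : RSpace d, Tendsto (fun n => χ ((R n)⁻¹ • x)) atTop (𝓝 1) := fun x => by
    rw [← hχ0]
    exact (hχ.continuous.tendsto _).comp (hRx x)
  set w : RSpace d → ℝ := fun x => (c * planeWave ξ x).re with hw
  have hw1 : ∀ x, |w x| ≤ ‖c‖ := fun x => by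
    refine (Complex.abs_re_le_norm _).trans ?_
    rw [norm_mul, norm_planeWave, mul_one]
  -- Test functions are real, so the real part is split into the waves of frequencies `ξ` and `-ξ`,
  -- to which the complex formulas apply.
  have hwC : ∀ x, (w x : ℂ) = c / 2 * planeWave ξ x +
      (starRingEnd ℂ) c / 2 * planeWave (-ξ) x := by
    intro x
    rw [hw, planeWave_neg_left]
    simp only [Complex.re_eq_add_conj, map_mul]
    ring
  have hwd : ContDiff ℝ ∞ w := Complex.reCLM.contDiff.comp (contDiff_const.mul (contDiff_planeWave ξ))
  have hw' : ∀ x, HasFDerivAt w (Complex.reCLM ∘L ((c * planeWave ξ x) • planePhase ξ)) x := by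
    intro x
    have h1 : HasFDerivAt (planeWave ξ) (planeWave ξ x • planePhase ξ) x :=
      (planePhase ξ).hasFDerivAt.cexp
    have h2 := Complex.reCLM.hasFDerivAt.comp x (h1.const_mul c)
    rw [smul_smul] at h2
    exact h2
  set f : ℕ → RSpace d → ℝ := fun n x => χ ((R n)⁻¹ • x) * w x with hf
  have hfd : ∀ n x, HasFDerivAt (f n) (χ ((R n)⁻¹ • x) • (Complex.reCLM ∘L
      ((c * planeWave ξ x) • planePhase ξ)) + w x • ((R n)⁻¹ • fderiv ℝ χ ((R n)⁻¹ • x))) x := by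
    intro n x
    have h1 : HasFDerivAt (fun x => χ ((R n)⁻¹ • x)) ((R n)⁻¹ • fderiv ℝ χ ((R n)⁻¹ • x)) x := by
      have h2 := ((hχ.differentiable (by simp)) ((R n)⁻¹ • x)).hasFDerivAt.comp x
        ((hasFDerivAt_id x).const_smul (R n)⁻¹)
      convert! h2 using 1
      ext v
      simp
    exact h1.mul (hw' x)
  have hfrac : ∀ n x, fracLaplacian s (f n) x =
      (c / 2 * fracLaplacianC s (fun x => planeWave ξ x * F ((R n)⁻¹ • x)) x +
      (starRingEnd ℂ) c / 2 * fracLaplacianC s (fun x => planeWave (-ξ) x * F ((R n)⁻¹ • x)) x).re := by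
    intro n x
    obtain ⟨G₁, h1⟩ := exists_schwartzMap_planeWave_mul_dilation F hF (hR0 n) ξ
    obtain ⟨G₂, h2⟩ := exists_schwartzMap_planeWave_mul_dilation F hF (hR0 n) (-ξ)
    rw [← h1, ← h2, ← fracLaplacianC_linear hs hs1, fracLaplacian_eq_re]
    congr 2
    ext v
    rw [h1, h2, hf, hFχ]
    simp only [Complex.ofReal_mul, hwC]
    ring
  refine ⟨f, max ‖c‖ (max (‖c‖ / 2 * (∫ ζ, dilationBound F ξ ζ) +
    ‖c‖ / 2 * (∫ ζ, dilationBound F (-ξ) ζ)) (‖c‖ * ‖planePhase ξ‖ + ‖c‖ * B)), fun n => ⟨?_, ?_⟩,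
    fun n x => ⟨?_, ?_, ?_⟩, fun x => ⟨?_, ?_, fun v => ?_⟩⟩
  · exact (hχ.comp (contDiff_const_smul _)).mul hwd
  · exact (hχc.comp_smul (inv_ne_zero (hR0 n).ne')).mul_right
  · refine le_max_of_le_left ?_
    rw [hf, abs_mul]
    exact (mul_le_of_le_one_left (abs_nonneg _) (hχ1 _)).trans (hw1 x)
  · refine le_max_of_le_right (le_max_of_le_left ?_)
    rw [hfrac]
    refine (Complex.abs_re_le_norm _).trans ((norm_add_le _ _).trans ?_)
    rw [norm_mul, norm_mul, norm_div, norm_div, RCLike.norm_conj, RCLike.norm_ofNat]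
    exact add_le_add
      (mul_le_mul_of_nonneg_left (norm_fracLaplacianC_planeWave_le hs hs1 F (hR n) ξ x)
        (by positivity))
      (mul_le_mul_of_nonneg_left (norm_fracLaplacianC_planeWave_le hs hs1 F (hR n) (-ξ) x)
        (by positivity))
  · refine le_max_of_le_right (le_max_of_le_right ?_)
    rw [(hfd n x).fderiv]
    refine (norm_add_le _ _).trans (add_le_add ?_ ?_)
    · rw [norm_smul]
      refine (mul_le_of_le_one_left (norm_nonneg _) (hχ1 _)).trans ?_
      refine (ContinuousLinearMap.opNorm_comp_le _ _).trans ?_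
      rw [Complex.reCLM_norm, one_mul, norm_smul, norm_mul, norm_planeWave, mul_one]
    · rw [norm_smul, norm_smul, Real.norm_of_nonneg (inv_nonneg.2 (hR0 n).le)]
      refine mul_le_mul (hw1 x) ?_ (by positivity) (norm_nonneg _)
      exact (mul_le_of_le_one_left (norm_nonneg _) (hRi n)).trans (hB _)
  · have h1 := (hχt x).mul_const (w x)
    rw [one_mul] at h1
    exact h1
  · have h1 := ((tendsto_fracLaplacianC_planeWave hs hs1 F hR hRt ξ x).const_mul (c / 2)).add
      ((tendsto_fracLaplacianC_planeWave hs hs1 F hR hRt (-ξ) x).const_mul ((starRingEnd ℂ) c / 2))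
    have h2 := (Complex.continuous_re.tendsto _).comp h1
    have h3 : c / 2 * (planeWave ξ x * ((fracSymbol s ξ : ℂ) * F 0)) + (starRingEnd ℂ) c / 2 *
        (planeWave (-ξ) x * ((fracSymbol s (-ξ) : ℂ) * F 0)) =
        ((c * (fracSymbol s ξ * planeWave ξ x)).re : ℂ) := by
      rw [Complex.re_eq_add_conj, hF0, planeWave_neg_left]
      simp only [map_mul, Complex.conj_ofReal, fracSymbol, norm_neg]
      ring
    rw [h3, Complex.ofReal_re] at h2
    refine h2.congr fun n => ?_
    rw [hfrac]
    rfl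
  · have h1 : Tendsto (fun n => w x * ((R n)⁻¹ * fderiv ℝ χ ((R n)⁻¹ • x) v)) atTop (𝓝 0) := by
      have h2 : Tendsto (fun n => fderiv ℝ χ ((R n)⁻¹ • x) v) atTop (𝓝 (fderiv ℝ χ 0 v)) :=
        (((hχ.continuous_fderiv (by simp)).clm_apply continuous_const).tendsto _).comp (hRx x)
      simpa using (hRt.mul h2).const_mul (w x)
    have h2 := ((hχt x).mul_const (c * planeWave ξ x * planePhase ξ v).re).add h1
    rw [one_mul, add_zero] at h2
    have h3 : c * (planePhase ξ v * planeWave ξ x) = c * planeWave ξ x * planePhase ξ v := by ring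
    rw [h3]
    refine h2.congr fun n => ?_
    rw [(hfd n x).fderiv]
    simp

/-! ### Weak differential equations in time and Gronwall's inequality. -/

/-- Integration by parts for absolutely continuous functions: both primitives vanish at `0` and are
differentiable almost everywhere. -/
theorem integral_mul_primitive_add {f g : ℝ → ℝ} {t : ℝ} (hf : IntervalIntegrable f volume 0 t)
    (hg : IntervalIntegrable g volume 0 t) :
    ∫ x in (0)..t, (f x * (∫ y in (0)..x, g y) + (∫ y in (0)..x, f y) * g x) =
      (∫ x in (0)..t, f x) * ∫ x in (0)..t, g x := by
  have h0 : (0 : ℝ) ∈ uIcc 0 t := left_mem_uIcc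
  have h1 := (hf.absolutelyContinuousOnInterval_intervalIntegral h0).integral_deriv_mul_eq_sub
    (hg.absolutelyContinuousOnInterval_intervalIntegral h0)
  simp only [intervalIntegral.integral_same, mul_zero, sub_zero] at h1
  rw [← h1]
  refine intervalIntegral.integral_congr_ae ?_
  filter_upwards [hf.ae_hasDerivAt_integral, hg.ae_hasDerivAt_integral] with x hx1 hx2 hx
  rw [(hx1 (uIoc_subset_uIcc hx) 0 h0).deriv, (hx2 (uIoc_subset_uIcc hx) 0 h0).deriv]

theorem intervalIntegrable_mul_primitive {f g : ℝ → ℝ} {t : ℝ}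
    (hf : IntervalIntegrable f volume 0 t) (hg : IntervalIntegrable g volume 0 t) :
    IntervalIntegrable (fun x => f x * ∫ y in (0)..x, g y) volume 0 t :=
  hf.mul_continuousOn (intervalIntegral.continuousOn_primitive_interval'
    hg left_mem_uIcc)

theorem integral_mul_primitive_self {f : ℝ → ℝ} {t : ℝ} (hf : IntervalIntegrable f volume 0 t) :
    2 * ∫ x in (0)..t, f x * (∫ y in (0)..x, f y) = (∫ x in (0)..t, f x) ^ 2 := by
  rw [sq, ← integral_mul_primitive_add hf hf, ← intervalIntegral.integral_const_mul]
  refine intervalIntegral.integral_congr fun x _ => ?_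
  ring

/-- A weak solution of `a' = -F` on `(0,T)` with `a(0) = 0`, tested against functions which need
not vanish at `0`, is the primitive of `-F`. -/
theorem ae_eq_neg_primitive_of_weak {T : ℝ} (hT : 0 < T) {a F : ℝ → ℝ} (ha : Integrable a)
    (hF : Integrable F) (ha0 : ∀ t ∉ Ioo 0 T, a t = 0) (hF0 : ∀ t ∉ Ioo 0 T, F t = 0)
    (hweak : ∀ ψ : ℝ → ℝ, ContDiff ℝ ∞ ψ → HasCompactSupport ψ → tsupport ψ ⊆ Iio T →
      ∫ t, (deriv ψ t * a t - ψ t * F t) = 0) :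
    ∀ᵐ t, t ∈ Ioo 0 T → a t = -∫ τ in (0)..t, F τ := by
  have hFi : ∀ x y, IntervalIntegrable F volume x y := fun x y => hF.intervalIntegrable
  have hPc : Continuous (fun t => ∫ τ in (0)..t, F τ) :=
    intervalIntegral.continuous_primitive hFi 0
  have hloc : LocallyIntegrable (fun t => a t + ∫ τ in (0)..t, F τ) :=
    ha.locallyIntegrable.add hPc.locallyIntegrable
  have main : ∀ η : ℝ → ℝ, ContDiff ℝ ∞ η → HasCompactSupport η → tsupport η ⊆ Ioo 0 T →
      ∫ t, η t • (a t + ∫ τ in (0)..t, F τ) = 0 := by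
    intro η hη hηc hηs
    obtain ⟨m, hm, hmη⟩ : ∃ m < T, ∀ t, m ≤ t → η t = 0 := by
      rcases (tsupport η).eq_empty_or_nonempty with h | h
      · refine ⟨0, hT, fun t _ => ?_⟩
        rw [tsupport_eq_empty_iff] at h
        simp [h]
      · obtain ⟨m, hm, hm'⟩ := hηc.isCompact.exists_isGreatest h
        refine ⟨(m + T) / 2, by linarith [(hηs hm).2], fun t ht => ?_⟩
        by_contra h0
        have := hm' (subset_tsupport η h0)
        linarith [(hηs hm).2]
    have hηi : ∀ x y, IntervalIntegrable η volume x y := fun x y =>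
      hη.continuous.intervalIntegrable _ _
    -- The primitive is normalized to vanish near `T` and may be nonzero at `0`. Such a test
    -- function is admissible, and this is how the zero initial value is used.
    set Ψ : ℝ → ℝ := fun t => ∫ τ in T..t, η τ with hΨ
    have hΨd : ∀ t, HasDerivAt Ψ (η t) t := fun t =>
      intervalIntegral.integral_hasDerivAt_right (hηi _ _)
        (hη.continuous.stronglyMeasurableAtFilter _ _) hη.continuous.continuousAt
    have hΨs : ContDiff ℝ ∞ Ψ := by
      rw [contDiff_infty_iff_deriv]
      refine ⟨fun t => (hΨd t).differentiableAt, ?_⟩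
      rwa [show deriv Ψ = η from funext fun t => (hΨd t).deriv]
    have hΨ0 : ∀ t, m ≤ t → Ψ t = 0 := by
      intro t ht
      rw [hΨ]
      simp only
      rw [intervalIntegral.integral_congr (g := fun _ => 0) fun τ hτ => hmη τ
        ((le_min hm.le ht).trans hτ.1)]
      simp
    -- `Ψ` can be a nonzero constant on negative times. The cutoff restores compact support without
    -- changing `Ψ` on `(0,T)`.
    let χ : ContDiffBump (0 : ℝ) := ⟨T, T + 1, hT, by linarith⟩
    have hχ1 : ∀ t ∈ Ioo 0 T, χ =ᶠ[𝓝 t] 1 := fun t ht =>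
      χ.eventuallyEq_one_of_mem_ball (by simp [χ, abs_of_pos ht.1, ht.2])
    set ψ : ℝ → ℝ := fun t => χ t * Ψ t with hψ
    have h1 := hweak ψ (χ.contDiff.mul hΨs) χ.hasCompactSupport.mul_right (by
      have : tsupport ψ ⊆ Iic m := by
        refine closure_minimal (fun t ht => ?_) isClosed_Iic
        by_contra h0
        exact ht (by simp [hψ, hΨ0 t (not_le.1 h0).le])
      exact this.trans (Iic_subset_Iio.2 hm))
    have h2 : ∫ t, (deriv ψ t * a t - ψ t * F t) = ∫ t, (η t * a t - Ψ t * F t) := by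
      refine integral_congr_ae (ae_of_all _ fun t => ?_)
      by_cases ht : t ∈ Ioo 0 T
      · have e1 : ψ =ᶠ[𝓝 t] Ψ := by
          filter_upwards [hχ1 t ht] with x hx
          simp [hψ, hx]
        simp only [e1.deriv_eq, (hΨd t).deriv, e1.eq_of_nhds]
      · simp [ha0 t ht, hF0 t ht]
    rw [h2] at h1
    have hηb : ∃ C, ∀ t, ‖η t‖ ≤ C := hηc.exists_bound_of_continuous hη.continuous
    obtain ⟨C, hC⟩ := hηb
    have i1 : Integrable (fun t => η t * a t) :=
      ha.bdd_mul (c := C) hη.continuous.aestronglyMeasurable (ae_of_all _ hC)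
    have hη0 : ∀ t ∉ Ioo 0 T, η t = 0 := fun t ht => by
      by_contra h0
      exact ht (hηs (subset_tsupport η h0))
    have i2 : Integrable (fun t => η t * ∫ τ in (0)..t, F τ) :=
      (hη.continuous.mul hPc).integrable_of_hasCompactSupport hηc.mul_right
    have h0Ioc : ∀ {f : ℝ → ℝ}, (∀ t ∉ Ioo 0 T, f t = 0) → ∫ t, f t = ∫ t in (0)..T, f t := by
      intro f hf
      rw [intervalIntegral.integral_of_le hT.le, setIntegral_eq_integral_of_forall_compl_eq_zero]
      exact fun t ht => hf t fun h => ht (Ioo_subset_Ioc_self h)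
    have h3 : ∫ t, Ψ t * F t = -∫ t, η t * ∫ τ in (0)..t, F τ := by
      rw [h0Ioc (fun t ht => by simp [hF0 t ht]), h0Ioc (fun t ht => by simp [hη0 t ht])]
      have e2 : ∀ t, Ψ t * F t = (∫ τ in (0)..t, η τ) * F t - (∫ τ in (0)..T, η τ) * F t := by
        intro t
        rw [← sub_mul, intervalIntegral.integral_interval_sub_left (hηi _ _) (hηi _ _)]
      have e3 := integral_mul_primitive_add (hηi 0 T) (hFi 0 T)
      have e4 : IntervalIntegrable (fun t => (∫ τ in (0)..t, η τ) * F t) volume 0 T := by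
        simpa only [mul_comm] using intervalIntegrable_mul_primitive (hFi 0 T) (hηi 0 T)
      rw [intervalIntegral.integral_add (intervalIntegrable_mul_primitive (hηi 0 T) (hFi 0 T)) e4]
        at e3
      simp_rw [e2]
      rw [intervalIntegral.integral_sub e4 ((hFi 0 T).const_mul _),
        intervalIntegral.integral_const_mul]
      linarith
    have i3 : Integrable (fun t => Ψ t * F t) := by
      by_contra h0
      have e5 : IntegrableOn (fun t => Ψ t * F t) (Ioo 0 T) :=
        ((hF.intervalIntegrable (a := 0) (b := T)).continuousOn_mul
          hΨs.continuous.continuousOn).1.mono_set Ioo_subset_Ioc_self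
      refine h0 ((integrableOn_iff_integrable_of_support_subset fun t ht => ?_).1 e5)
      by_contra h6
      exact ht (by simp [hF0 t h6])
    rw [integral_sub i1 i3, h3] at h1
    simp only [smul_eq_mul, mul_add]
    rw [integral_add i1 i2]
    linarith
  have h1 := isOpen_Ioo.ae_eq_zero_of_integral_contDiff_smul_eq_zero
    (hloc.locallyIntegrableOn (Ioo 0 T)) main
  filter_upwards [h1] with t ht htT
  linarith [ht htT]

theorem ae_eq_neg_primitive_of_weak_complex {T : ℝ} (hT : 0 < T) {a F : ℝ → ℂ} (ha : Integrable a)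
    (hF : Integrable F) (ha0 : ∀ t ∉ Ioo 0 T, a t = 0) (hF0 : ∀ t ∉ Ioo 0 T, F t = 0)
    (hweak : ∀ ψ : ℝ → ℝ, ContDiff ℝ ∞ ψ → HasCompactSupport ψ → tsupport ψ ⊆ Iio T →
      ∫ t, (((deriv ψ t : ℝ) : ℂ) * a t - ψ t * F t) = 0) :
    ∀ᵐ t, t ∈ Ioo 0 T → (a t).re = -(∫ τ in (0)..t, (F τ).re) ∧
      (a t).im = -(∫ τ in (0)..t, (F τ).im) := by
  have hint : ∀ ψ : ℝ → ℝ, ContDiff ℝ ∞ ψ → HasCompactSupport ψ →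
      Integrable (fun t => ((deriv ψ t : ℝ) : ℂ) * a t - ψ t * F t) := by
    intro ψ hψ hψc
    obtain ⟨C, hC⟩ := hψc.exists_bound_of_continuous hψ.continuous
    obtain ⟨C', hC'⟩ := hψc.deriv.exists_bound_of_continuous (hψ.continuous_deriv (by simp))
    refine (ha.bdd_mul (c := C') (Complex.continuous_ofReal.comp
      (hψ.continuous_deriv (by simp))).aestronglyMeasurable (ae_of_all _ fun t => ?_)).sub
      (hF.bdd_mul (c := C) (Complex.continuous_ofReal.comp
      hψ.continuous).aestronglyMeasurable (ae_of_all _ fun t => ?_))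
    · simpa using hC' t
    · simpa using hC t
  have h1 := ae_eq_neg_primitive_of_weak hT ha.re hF.re (fun t ht => by simp [ha0 t ht])
    (fun t ht => by simp [hF0 t ht]) (fun ψ h1 h2 h3 => by
      have h4 := congrArg (RCLike.re (K := ℂ)) (hweak ψ h1 h2 h3)
      rw [← integral_re (hint ψ h1 h2)] at h4
      simpa using h4)
  have h2 := ae_eq_neg_primitive_of_weak hT ha.im hF.im (fun t ht => by simp [ha0 t ht])
    (fun t ht => by simp [hF0 t ht]) (fun ψ h1 h2 h3 => by
      have h4 := congrArg (RCLike.im (K := ℂ)) (hweak ψ h1 h2 h3)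
      rw [← integral_im (hint ψ h1 h2)] at h4
      simpa using h4)
  filter_upwards [h1, h2] with t ht1 ht2 ht
  exact ⟨ht1 ht, ht2 ht⟩

/-- The chain rule for `‖a‖²` in integrated form: the square of a primitive is the integral of twice
the function times its primitive, applied to real and imaginary parts. -/
theorem ae_normSq_eq_integral {T : ℝ} {a F : ℝ → ℂ}
    (hF : Integrable F) (h : ∀ᵐ t, t ∈ Ioo 0 T → (a t).re = -(∫ τ in (0)..t, (F τ).re) ∧
      (a t).im = -(∫ τ in (0)..t, (F τ).im)) :
    ∀ᵐ t, t ∈ Ioo 0 T → ‖a t‖ ^ 2 =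
      ∫ τ in (0)..t, (-2 * ((starRingEnd ℂ) (a τ) * F τ).re) := by
  filter_upwards [h] with t ht htT
  obtain ⟨h1, h2⟩ := ht htT
  have hr : IntervalIntegrable (fun t => (F t).re) volume 0 t := hF.re.intervalIntegrable
  have hi : IntervalIntegrable (fun t => (F t).im) volume 0 t := hF.im.intervalIntegrable
  rw [← Complex.normSq_eq_norm_sq, Complex.normSq_apply, h1, h2, neg_mul_neg, neg_mul_neg,
    ← sq, ← sq, ← integral_mul_primitive_self hr, ← integral_mul_primitive_self hi, ← mul_add,
    ← intervalIntegral.integral_add (intervalIntegrable_mul_primitive hr hr)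
    (intervalIntegrable_mul_primitive hi hi), ← intervalIntegral.integral_const_mul]
  refine intervalIntegral.integral_congr_ae ?_
  filter_upwards [h] with τ hτ hτt
  rw [uIoc_of_le htT.1.le] at hτt
  obtain ⟨h3, h4⟩ := hτ ⟨hτt.1, hτt.2.trans_lt htT.2⟩
  have h5 : ∫ y in (0)..τ, (F y).re = -(a τ).re := by linarith
  have h6 : ∫ y in (0)..τ, (F y).im = -(a τ).im := by linarith
  rw [h5, h6]
  simp only [Complex.mul_re, Complex.conj_re, Complex.conj_im]
  ring

/-- Gronwall's inequality for integrable functions. -/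
theorem ae_eq_zero_of_le_integral {T C : ℝ} (hC : 0 ≤ C) {H : ℝ → ℝ} (hH : Integrable H)
    (hH0 : ∀ t, 0 ≤ H t) (h : ∀ᵐ t, t ∈ Ioo 0 T → H t ≤ C * ∫ τ in (0)..t, H τ) :
    ∀ᵐ t, t ∈ Ioo 0 T → H t = 0 := by
  have hHi : ∀ x y, IntervalIntegrable H volume x y := fun x y => hH.intervalIntegrable
  set Y : ℝ → ℝ := fun t => ∫ τ in (0)..t, H τ with hY
  have hYc : Continuous Y := intervalIntegral.continuous_primitive hHi 0
  -- The hypothesis on `H` holds only almost everywhere. Integrating it once gives `Y ≤ C S` at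
  -- every time, and `S' = Y` with `Y` continuous, so the differential form of Gronwall applies to
  -- `S`.
  set S : ℝ → ℝ := fun t => ∫ τ in (0)..t, Y τ with hS
  have hSd : ∀ t, HasDerivAt S (Y t) t := fun t =>
    intervalIntegral.integral_hasDerivAt_right (hYc.intervalIntegrable _ _)
      (hYc.stronglyMeasurableAtFilter _ _) hYc.continuousAt
  have hY0 : ∀ t, 0 ≤ t → 0 ≤ Y t := fun t ht =>
    intervalIntegral.integral_nonneg ht fun x _ => hH0 x
  have hYS : ∀ t ∈ Ioo 0 T, Y t ≤ C * S t := by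
    intro t ht
    simp only [hS, hY]
    rw [← intervalIntegral.integral_const_mul, intervalIntegral.integral_of_le ht.1.le,
      intervalIntegral.integral_of_le ht.1.le]
    refine setIntegral_mono_on_ae hH.integrableOn
      ((hYc.intervalIntegrable 0 t).const_mul C).1 measurableSet_Ioc ?_
    filter_upwards [h] with τ hτ hτt
    exact hτ ⟨hτt.1, hτt.2.trans_lt ht.2⟩
  have hS0 : ∀ t ∈ Ioo 0 T, S t = 0 := by
    intro t ht
    refine eq_zero_of_abs_deriv_le_mul_abs_self_of_eq_zero_right (K := C) (f' := Y) (a := 0)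
      (b := t) (fun x _ => (hSd x).continuousAt.continuousWithinAt)
      (fun x _ => (hSd x).hasDerivWithinAt) (by simp [hS]) (fun x hx => ?_) t ⟨ht.1.le, le_rfl⟩
    rcases hx.1.eq_or_lt with rfl | h0
    · simp [hS, hY]
    · rw [Real.norm_of_nonneg (hY0 x hx.1)]
      exact (hYS x ⟨h0, hx.2.trans ht.2⟩).trans
        (mul_le_mul_of_nonneg_left (le_abs_self _) hC)
  filter_upwards [h] with t ht htT
  have h1 := hYS t htT
  rw [hS0 t htT, mul_zero] at h1
  have h2 := ht htT
  have h3 : C * Y t ≤ 0 := mul_nonpos_of_nonneg_of_nonpos hC h1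
  exact le_antisymm (h2.trans h3) (hH0 t)

/-! ### Plancherel's theorem and the Fourier transform in space. -/

theorem norm_fourier_le_integral_norm {d : ℕ} (f : RSpace d → ℂ) (ξ : RSpace d) :
    ‖𝓕 f ξ‖ ≤ ∫ x, ‖f x‖ := by
  rw [fourier_eq_integral_planeWave]
  refine (norm_integral_le_integral_norm _).trans (le_of_eq ?_)
  simp only [norm_mul, norm_planeWave, one_mul]

/-- Both transforms are locally integrable and have the same pairing with every test function,
because the Fourier transform is its own transpose. Plancherel's identity for `Lp` then passes to
the integral formula. -/
theorem fourier_ae_eq_fourier_toLp {d : ℕ} {f : RSpace d → ℂ} (hf : Integrable f)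
    (hf2 : MemLp f 2) : 𝓕 f =ᵐ[volume] (𝓕 (hf2.toLp f) : Lp (α := RSpace d) ℂ 2) := by
  have hc : Continuous (𝓕 f) :=
    VectorFourier.fourierIntegral_continuous Real.continuous_fourierChar
      (by exact continuous_inner) hf
  refine ae_eq_of_integral_contDiff_smul_eq hc.locallyIntegrable
    ((Lp.memLp _).locallyIntegrable one_le_two) fun g hg hgc => ?_
  obtain ⟨G, -, hG⟩ := exists_schwartzMap_eq hg hgc
  have h1 := congrArg (fun u => u G) (Lp.fourier_toTemperedDistribution_eq (hf2.toLp f))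
  simp only [TemperedDistribution.fourier_apply, Lp.toTemperedDistribution_apply] at h1
  have h2 : ∀ x (c : ℂ), g x • c = G x • c := fun x c => by
    rw [hG, Complex.real_smul, smul_eq_mul]
  simp_rw [h2]
  rw [← h1]
  have h3 := VectorFourier.integral_fourierIntegral_smul_eq_flip (μ := volume) (ν := volume)
    (L := innerₗ (RSpace d)) (f := G) (g := f) Real.continuous_fourierChar
    (by exact continuous_inner) G.integrable hf
  rw [flip_innerₗ] at h3
  refine h3.symm.trans (integral_congr_ae ?_)
  filter_upwards [hf2.coeFn_toLp] with x hx
  rw [hx]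
  rfl

/-- Plancherel's theorem for the pointwise Fourier transform of real functions in `L¹ ∩ L²`. -/
theorem integral_conj_fourier_mul_fourier {d : ℕ} {f g : RSpace d → ℝ} (hf : Integrable f)
    (hf2 : MemLp f 2) (hg : Integrable g) (hg2 : MemLp g 2) :
    MemLp (𝓕 (fun x => (f x : ℂ))) 2 ∧
    Integrable (fun ξ => ((starRingEnd ℂ) (𝓕 (fun x => (f x : ℂ)) ξ) *
      𝓕 (fun x => (g x : ℂ)) ξ).re) ∧
    ∫ ξ, ((starRingEnd ℂ) (𝓕 (fun x => (f x : ℂ)) ξ) * 𝓕 (fun x => (g x : ℂ)) ξ).re =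
      ∫ x, f x * g x := by
  have hF : Integrable (fun x => (f x : ℂ)) := hf.ofReal
  have hG : Integrable (fun x => (g x : ℂ)) := hg.ofReal
  have hF2 : MemLp (fun x => (f x : ℂ)) 2 := hf2.ofReal
  have hG2 : MemLp (fun x => (g x : ℂ)) 2 := hg2.ofReal
  have h1 := fourier_ae_eq_fourier_toLp hF hF2
  have h2 := fourier_ae_eq_fourier_toLp hG hG2
  have hm1 := (memLp_congr_ae h1).2 (Lp.memLp _)
  have hm2 := (memLp_congr_ae h2).2 (Lp.memLp _)
  have hint : Integrable (fun ξ => (starRingEnd ℂ) (𝓕 (fun x => (f x : ℂ)) ξ) *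
      𝓕 (fun x => (g x : ℂ)) ξ) := by
    have := MemLp.integrable_mul hm1.star hm2
    exact this
  refine ⟨hm1, hint.re, ?_⟩
  have h3 := Lp.inner_fourier_eq (hF2.toLp _) (hG2.toLp _)
  rw [L2.inner_def, L2.inner_def] at h3
  have h4 : ∫ ξ, (starRingEnd ℂ) (𝓕 (fun x => (f x : ℂ)) ξ) * 𝓕 (fun x => (g x : ℂ)) ξ =
      ∫ x, ((f x * g x : ℝ) : ℂ) := by
    refine (integral_congr_ae ?_).trans (h3.trans (integral_congr_ae ?_))
    · filter_upwards [h1, h2] with ξ e1 e2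
      rw [e1, e2, RCLike.inner_apply, mul_comm]
    · filter_upwards [hF2.coeFn_toLp, hG2.coeFn_toLp] with x e1 e2
      rw [e1, e2, RCLike.inner_apply, mul_comm]
      simp
  have h5 := congrArg (RCLike.re (K := ℂ)) h4
  rw [← integral_re hint, integral_complex_ofReal] at h5
  simpa using h5

theorem integral_norm_fourier_sq {d : ℕ} {f : RSpace d → ℝ} (hf : Integrable f)
    (hf2 : MemLp f 2) :
    Integrable (fun ξ => ‖𝓕 (fun x => (f x : ℂ)) ξ‖ ^ 2) ∧
    ∫ ξ, ‖𝓕 (fun x => (f x : ℂ)) ξ‖ ^ 2 = ∫ x, f x ^ 2 := by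
  obtain ⟨-, h1, h2⟩ := integral_conj_fourier_mul_fourier hf hf2 hf hf2
  have h3 : ∀ z : ℂ, ((starRingEnd ℂ) z * z).re = ‖z‖ ^ 2 := fun z => by
    rw [← Complex.normSq_eq_conj_mul_self, Complex.ofReal_re, Complex.normSq_eq_norm_sq]
  simp only [h3, ← sq] at h1 h2
  exact ⟨h1, h2⟩

/-- The Fourier transform in the space variable. -/
noncomputable def spaceFourier {d : ℕ} (g : ℝ × RSpace d → ℝ) (t : ℝ) (ξ : RSpace d) : ℂ :=
  𝓕 (fun x => (g (t, x) : ℂ)) ξ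

theorem stronglyMeasurable_spaceFourier {d : ℕ} {g : ℝ × RSpace d → ℝ} (hg : Measurable g) :
    StronglyMeasurable (fun p : ℝ × RSpace d => spaceFourier g p.1 p.2) := by
  have h1 : Measurable (fun p : (ℝ × RSpace d) × RSpace d =>
      planeWave p.1.2 p.2 * (g (p.1.1, p.2) : ℂ)) := by
    have h2 : Measurable (fun p : (ℝ × RSpace d) × RSpace d => planeWave p.1.2 p.2) := by
      simp only [planeWave, planePhase_apply]
      fun_prop
    have h3 : Measurable (fun p : (ℝ × RSpace d) × RSpace d => g (p.1.1, p.2)) :=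
      hg.comp (by fun_prop)
    exact h2.mul (Complex.measurable_ofReal.comp h3)
  have h2 := h1.stronglyMeasurable.integral_prod_right' (ν := (volume : Measure (RSpace d)))
  simp only [spaceFourier, fourier_eq_integral_planeWave]
  exact h2

theorem ae_integrable_slices {d : ℕ} {g : ℝ × RSpace d → ℝ} (hgm : Measurable g)
    (hg : Integrable g) (hg2 : Integrable (fun p => g p ^ 2)) :
    ∀ᵐ t : ℝ, Integrable (fun x => g (t, x)) ∧ MemLp (fun x => g (t, x)) 2 := by
  rw [Measure.volume_eq_prod] at hg hg2
  filter_upwards [hg.prod_right_ae, hg2.prod_right_ae] with t h1 h2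
  refine ⟨h1, (memLp_two_iff_integrable_sq ?_).2 h2⟩
  exact (hgm.comp measurable_prodMk_left).aestronglyMeasurable

theorem integrable_norm_spaceFourier_sq {d : ℕ} {g : ℝ × RSpace d → ℝ} (hgm : Measurable g)
    (hg : Integrable g) (hg2 : Integrable (fun p => g p ^ 2)) :
    Integrable (fun p : ℝ × RSpace d => ‖spaceFourier g p.1 p.2‖ ^ 2) := by
  have h0 := ae_integrable_slices hgm hg hg2
  rw [Measure.volume_eq_prod] at hg hg2 ⊢
  have hm : AEStronglyMeasurable (fun p : ℝ × RSpace d => ‖spaceFourier g p.1 p.2‖ ^ 2)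
      (volume.prod volume) :=
    ((stronglyMeasurable_spaceFourier hgm).norm.pow 2).aestronglyMeasurable
  rw [integrable_prod_iff hm]
  constructor
  · filter_upwards [h0] with t ht
    exact (integral_norm_fourier_sq ht.1 ht.2).1
  · refine hg2.integral_prod_left.congr ?_
    filter_upwards [h0] with t ht
    simp only [norm_pow, norm_norm]
    exact (integral_norm_fourier_sq ht.1 ht.2).2.symm

theorem integrable_spaceFourier_left {d : ℕ} {g : ℝ × RSpace d → ℝ} (hgm : Measurable g)
    (hg : Integrable g) (ξ : RSpace d) : Integrable (fun t => spaceFourier g t ξ) := by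
  rw [Measure.volume_eq_prod] at hg
  refine hg.norm.integral_prod_left.mono' ((stronglyMeasurable_spaceFourier hgm).comp_measurable
    measurable_prodMk_right).aestronglyMeasurable (ae_of_all _ fun t => ?_)
  refine (norm_fourier_le_integral_norm _ _).trans (le_of_eq ?_)
  simp only [Complex.norm_real]

/-! ### The equation at a fixed frequency. -/

/-- `z` is a weak solution of `z_t + (-Δ)^s (w z) + div (z v) = 0` on `(0,T) × ℝ^d` with zero
initial datum, tested against products, and extended by zero to all times. -/
structure IsZeroDataSolution {d : ℕ} (s T : ℝ) (z w : ℝ × RSpace d → ℝ)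
    (v : ℝ × RSpace d → RSpace d) (W B : ℝ) : Prop where
  measurable_z : Measurable z
  measurable_w : Measurable w
  measurable_v : Measurable v
  integrable : Integrable z
  integrable_sq : Integrable (fun p => z p ^ 2)
  eq_zero : ∀ t ∉ Ioo 0 T, ∀ x, z (t, x) = 0
  w_nonneg : ∀ p, 0 ≤ w p
  w_le : ∀ p, w p ≤ W
  norm_v_le : ∀ p, ‖v p‖ ≤ B
  weak : ∀ ψ : ℝ → ℝ, ContDiff ℝ ∞ ψ → HasCompactSupport ψ → tsupport ψ ⊆ Iio T →
    ∀ f : RSpace d → ℝ, ContDiff ℝ ∞ f → HasCompactSupport f →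
      ∫ p, (z p * (deriv ψ p.1 * f p.2) - (ψ p.1 * fracLaplacian s f p.2) * (w p * z p)
        + z p * (ψ p.1 * fderiv ℝ f p.2 (v p))) = 0

namespace IsZeroDataSolution

variable {d : ℕ} {s T : ℝ} {z w : ℝ × RSpace d → ℝ} {v : ℝ × RSpace d → RSpace d} {W B : ℝ}

/-- The weak formulation for `ψ(t) exp (-2πi⟪x, ξ⟫)`: the integrand. -/
noncomputable def planeIntegrand (s : ℝ) (z w : ℝ × RSpace d → ℝ) (v : ℝ × RSpace d → RSpace d)
    (ψ : ℝ → ℝ) (ξ : RSpace d) (p : ℝ × RSpace d) : ℂ :=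
  z p * ((deriv ψ p.1 : ℝ) * planeWave ξ p.2) -
    (ψ p.1 * (fracSymbol s ξ * planeWave ξ p.2)) * ((w p : ℂ) * z p) +
    z p * (ψ p.1 * (planePhase ξ (v p) * planeWave ξ p.2))

theorem measurable_planeWave (ξ : RSpace d) :
    Measurable (fun p : ℝ × RSpace d => planeWave ξ p.2) := by
  simp only [planeWave, planePhase_apply]
  fun_prop

theorem integrable_bounded_mul {g : ℝ × RSpace d → ℂ} (h : IsZeroDataSolution s T z w v W B)
    (hg : Measurable g) {C : ℝ} (hC : ∀ p, ‖g p‖ ≤ C) : Integrable (fun p => g p * z p) :=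
  h.integrable.ofReal.bdd_mul (c := C) hg.aestronglyMeasurable (ae_of_all _ hC)

theorem abs_w_le (h : IsZeroDataSolution s T z w v W B) (p : ℝ × RSpace d) : |w p| ≤ W := by
  rw [abs_of_nonneg (h.w_nonneg p)]
  exact h.w_le p

theorem integrable_terms (h : IsZeroDataSolution s T z w v W B) (ξ : RSpace d) :
    Integrable (fun p : ℝ × RSpace d => planeWave ξ p.2 * z p) ∧
    Integrable (fun p : ℝ × RSpace d => planeWave ξ p.2 * ((w p : ℂ) * z p)) ∧
    Integrable (fun p : ℝ × RSpace d => planeWave ξ p.2 * (planePhase ξ (v p) * z p)) := by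
  refine ⟨h.integrable_bounded_mul (measurable_planeWave ξ) (C := 1)
    (fun p => (norm_planeWave _ _).le), ?_, ?_⟩
  · have := h.integrable_bounded_mul (g := fun p => planeWave ξ p.2 * w p)
      ((measurable_planeWave ξ).mul (Complex.measurable_ofReal.comp h.measurable_w)) (C := W)
      (fun p => by
        rw [norm_mul, norm_planeWave, one_mul, Complex.norm_real]
        exact h.abs_w_le p)
    simpa only [mul_assoc] using this
  · have hm : Measurable (fun p => planePhase ξ (v p)) :=
      (planePhase ξ).continuous.measurable.comp h.measurable_v
    have := h.integrable_bounded_mul (g := fun p => planeWave ξ p.2 * planePhase ξ (v p))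
      ((measurable_planeWave ξ).mul hm) (C := ‖planePhase ξ‖ * B)
      (fun p => by
        rw [norm_mul, norm_planeWave, one_mul]
        exact (planePhase ξ).le_opNorm_of_le (h.norm_v_le p))
    simpa only [mul_assoc] using this

theorem planeIntegrand_eq (ψ : ℝ → ℝ) (ξ : RSpace d) (p : ℝ × RSpace d) :
    planeIntegrand s z w v ψ ξ p = ((deriv ψ p.1 : ℝ) : ℂ) * (planeWave ξ p.2 * z p) -
      ψ p.1 * (fracSymbol s ξ * (planeWave ξ p.2 * ((w p : ℂ) * z p))) +
      ψ p.1 * (planeWave ξ p.2 * (planePhase ξ (v p) * z p)) := by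
  simp only [planeIntegrand]
  ring

theorem integrable_time_mul {g : ℝ × RSpace d → ℂ} (hg : Integrable g) {ψ : ℝ → ℝ}
    (hψ : Continuous ψ) (hψc : HasCompactSupport ψ) :
    Integrable (fun p : ℝ × RSpace d => (ψ p.1 : ℂ) * g p) := by
  obtain ⟨C, hC⟩ := hψc.exists_bound_of_continuous hψ
  refine hg.bdd_mul (c := C) ?_ (ae_of_all _ fun p => ?_)
  · exact (Complex.continuous_ofReal.comp (hψ.comp continuous_fst)).aestronglyMeasurable
  · rw [Complex.norm_real]
    exact hC _

theorem integrable_planeIntegrand (h : IsZeroDataSolution s T z w v W B) {ψ : ℝ → ℝ}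
    (hψ : ContDiff ℝ ∞ ψ) (hψc : HasCompactSupport ψ) (ξ : RSpace d) :
    Integrable (planeIntegrand s z w v ψ ξ) := by
  obtain ⟨h1, h2, h3⟩ := h.integrable_terms ξ
  refine (((integrable_time_mul h1 (hψ.continuous_deriv (by simp)) hψc.deriv).sub
    (integrable_time_mul (h2.const_mul (fracSymbol s ξ : ℂ)) hψ.continuous hψc)).add
    (integrable_time_mul h3 hψ.continuous hψc)).congr (ae_of_all _ fun p => ?_)
  rw [planeIntegrand_eq]
  rfl

/-- Passage to the limit from truncated waves: test functions, fractional Laplacians and gradients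
are uniformly bounded, so a constant multiple of `|z| ∈ L¹` dominates. -/
theorem integral_re_planeIntegrand (h : IsZeroDataSolution s T z w v W B) (hs : 0 ≤ s)
    (hs1 : s ≤ 1) {ψ : ℝ → ℝ} (hψ : ContDiff ℝ ∞ ψ) (hψc : HasCompactSupport ψ)
    (hψT : tsupport ψ ⊆ Iio T) (ξ : RSpace d) (c : ℂ) :
    ∫ p, (c * planeIntegrand s z w v ψ ξ p).re = 0 := by
  obtain ⟨f, M, hf, hM, hlim⟩ := exists_testFunction_tendsto_planeWave hs hs1 ξ c
  obtain ⟨C, hC⟩ := hψc.exists_bound_of_continuous hψ.continuous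
  obtain ⟨C', hC'⟩ := hψc.deriv.exists_bound_of_continuous (hψ.continuous_deriv (by simp))
  have hM0 : 0 ≤ M := (abs_nonneg _).trans (hM 0 0).1
  have hC0 : 0 ≤ C := (norm_nonneg _).trans (hC 0)
  have hC0' : 0 ≤ C' := (norm_nonneg _).trans (hC' 0)
  have hint : ∀ n, ∫ p, (z p * (deriv ψ p.1 * f n p.2) -
      (ψ p.1 * fracLaplacian s (f n) p.2) * (w p * z p)
        + z p * (ψ p.1 * fderiv ℝ (f n) p.2 (v p))) = 0 := fun n =>
    h.weak ψ hψ hψc hψT (f n) (hf n).1 (hf n).2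
  have hmeasL : ∀ n, Measurable (fracLaplacian s (f n)) := by
    intro n
    have h1 : StronglyMeasurable (fun x : RSpace d => ∫ ξ, planeWave (-ξ) x *
        ((fracSymbol s ξ : ℂ) * 𝓕 (fun x => ((f n x : ℝ) : ℂ)) ξ)) := by
      have hc : Continuous (𝓕 (fun x => ((f n x : ℝ) : ℂ))) :=
        VectorFourier.fourierIntegral_continuous Real.continuous_fourierChar
          (by exact continuous_inner)
          ((hf n).1.continuous.integrable_of_hasCompactSupport (hf n).2).ofReal
      have h2 : Measurable (fun p : RSpace d × RSpace d => planeWave (-p.2) p.1) := by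
        simp only [planeWave, planePhase_apply]
        fun_prop
      have h3 : Measurable (fun p : RSpace d × RSpace d => ((fracSymbol s p.2 : ℂ) *
          𝓕 (fun x => ((f n x : ℝ) : ℂ)) p.2)) := by
        have := (Complex.continuous_ofReal.comp (continuous_fracSymbol d hs)).mul hc
        exact this.measurable.comp measurable_snd
      exact (h2.mul h3).stronglyMeasurable.integral_prod_right'
    have h4 : fracLaplacian s (f n) = fun x => (∫ ξ, planeWave (-ξ) x *
        ((fracSymbol s ξ : ℂ) * 𝓕 (fun x => ((f n x : ℝ) : ℂ)) ξ)).re := by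
      ext x
      rw [fracLaplacian_eq_re, fracLaplacianC, fourierInv_eq_integral_planeWave]
    rw [h4]
    exact Complex.measurable_re.comp h1.measurable
  have key := tendsto_integral_of_dominated_convergence (μ := (volume : Measure (ℝ × RSpace d)))
    (F := fun n p => z p * (deriv ψ p.1 * f n p.2) -
      (ψ p.1 * fracLaplacian s (f n) p.2) * (w p * z p)
        + z p * (ψ p.1 * fderiv ℝ (f n) p.2 (v p)))
    (f := fun p => (c * planeIntegrand s z w v ψ ξ p).re)
    (fun p => (C' * M + C * M * W + C * (M * B)) * |z p|) (fun n => ?_)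
    (h.integrable.norm.const_mul _) (fun n => ae_of_all _ fun p => ?_) (ae_of_all _ fun p => ?_)
  · simp only [hint] at key
    exact tendsto_nhds_unique key tendsto_const_nhds
  · have m1 : Measurable (fun p : ℝ × RSpace d => deriv ψ p.1 * f n p.2) :=
      ((hψ.continuous_deriv (by simp)).measurable.comp measurable_fst).mul
        ((hf n).1.continuous.measurable.comp measurable_snd)
    have m2 : Measurable (fun p : ℝ × RSpace d => ψ p.1 * fracLaplacian s (f n) p.2) :=
      (hψ.continuous.measurable.comp measurable_fst).mul ((hmeasL n).comp measurable_snd)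
    have m3 : Measurable (fun p : ℝ × RSpace d => fderiv ℝ (f n) p.2 (v p)) := by
      have e1 : Continuous (fun q : RSpace d × RSpace d => fderiv ℝ (f n) q.1 q.2) :=
        (((hf n).1.continuous_fderiv (by simp)).comp continuous_fst).clm_apply continuous_snd
      exact e1.measurable.comp (measurable_snd.prodMk h.measurable_v)
    exact (((h.measurable_z.mul m1).sub (m2.mul (h.measurable_w.mul h.measurable_z))).add
      (h.measurable_z.mul ((hψ.continuous.measurable.comp measurable_fst).mul
        m3))).aestronglyMeasurable
  · obtain ⟨b1, b2, b3⟩ := hM n p.2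
    have b4 : |fderiv ℝ (f n) p.2 (v p)| ≤ M * B :=
      ((fderiv ℝ (f n) p.2).le_opNorm_of_le (h.norm_v_le p)).trans
        (mul_le_mul_of_nonneg_right b3 ((norm_nonneg _).trans (h.norm_v_le p)))
    have b5 := hC p.1
    have b6 := hC' p.1
    have b7 := h.abs_w_le p
    rw [Real.norm_eq_abs] at b5 b6 ⊢
    refine (abs_add_le _ _).trans ((add_le_add_left (abs_sub _ _) _).trans ?_)
    simp only [abs_mul]
    have c1 : |deriv ψ p.1| * |f n p.2| ≤ C' * M := by gcongr
    have c2 : |ψ p.1| * |fracLaplacian s (f n) p.2| * |w p| ≤ C * M * W := by gcongr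
    have c3 : |ψ p.1| * |fderiv ℝ (f n) p.2 (v p)| ≤ C * (M * B) := by gcongr
    nlinarith [mul_le_mul_of_nonneg_right c1 (abs_nonneg (z p)),
      mul_le_mul_of_nonneg_right c2 (abs_nonneg (z p)),
      mul_le_mul_of_nonneg_right c3 (abs_nonneg (z p))]
  · obtain ⟨l1, l2, l3⟩ := hlim p.2
    have e : (c * planeIntegrand s z w v ψ ξ p).re =
        z p * (deriv ψ p.1 * (c * planeWave ξ p.2).re) -
        (ψ p.1 * (c * (fracSymbol s ξ * planeWave ξ p.2)).re) * (w p * z p)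
        + z p * (ψ p.1 * (c * (planePhase ξ (v p) * planeWave ξ p.2)).re) := by
      have e1 : c * planeIntegrand s z w v ψ ξ p =
          ((z p * deriv ψ p.1 : ℝ) : ℂ) * (c * planeWave ξ p.2) -
          ((ψ p.1 * (w p * z p) : ℝ) : ℂ) * (c * (fracSymbol s ξ * planeWave ξ p.2)) +
          ((z p * ψ p.1 : ℝ) : ℂ) * (c * (planePhase ξ (v p) * planeWave ξ p.2)) := by
        simp only [planeIntegrand]
        push_cast
        ring
      rw [e1, Complex.add_re, Complex.sub_re, Complex.re_ofReal_mul, Complex.re_ofReal_mul,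
        Complex.re_ofReal_mul]
      ring
    rw [e]
    exact (((l1.const_mul _).const_mul _).sub ((l2.const_mul _).mul_const _)).add
      (((l3 (v p)).const_mul _).const_mul _)

theorem integral_planeIntegrand (h : IsZeroDataSolution s T z w v W B) (hs : 0 ≤ s)
    (hs1 : s ≤ 1) {ψ : ℝ → ℝ} (hψ : ContDiff ℝ ∞ ψ) (hψc : HasCompactSupport ψ)
    (hψT : tsupport ψ ⊆ Iio T) (ξ : RSpace d) :
    ∫ p, planeIntegrand s z w v ψ ξ p = 0 := by
  have hi := h.integrable_planeIntegrand hψ hψc ξ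
  have key : ∀ c : ℂ, (c * ∫ p, planeIntegrand s z w v ψ ξ p).re = 0 := by
    intro c
    rw [← integral_const_mul]
    have := integral_re (hi.const_mul c)
    simp only [RCLike.re_eq_complex_re] at this
    rw [← this]
    exact h.integral_re_planeIntegrand hs hs1 hψ hψc hψT ξ c
  apply Complex.ext
  · simpa using key 1
  -- Multiplication by `-i` turns the imaginary part into a real part.
  · simpa using key (-Complex.I)

/-- The space Fourier transform of `(-Δ)^s (w z) + div (z v)`. -/
noncomputable def fluxFourier (s : ℝ) (z w : ℝ × RSpace d → ℝ) (v : ℝ × RSpace d → RSpace d)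
    (t : ℝ) (ξ : RSpace d) : ℂ :=
  fracSymbol s ξ * spaceFourier (fun p => w p * z p) t ξ +
    2 * Real.pi * Complex.I * ∑ j, (ξ j : ℂ) * spaceFourier (fun p => v p j * z p) t ξ

theorem integrable_v_mul (h : IsZeroDataSolution s T z w v W B) (j : Fin d) :
    Measurable (fun p => v p j * z p) ∧ Integrable (fun p => v p j * z p) ∧
      Integrable (fun p => (v p j * z p) ^ 2) := by
  have hm : Measurable (fun p => v p j) :=
    (EuclideanSpace.proj (𝕜 := ℝ) j).continuous.measurable.comp h.measurable_v
  have hb : ∀ p, ‖v p j‖ ≤ B := fun p => (PiLp.norm_apply_le (v p) j).trans (h.norm_v_le p)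
  refine ⟨hm.mul h.measurable_z, h.integrable.bdd_mul hm.aestronglyMeasurable (ae_of_all _ hb), ?_⟩
  simp only [mul_pow]
  refine h.integrable_sq.bdd_mul (c := B ^ 2) (hm.pow_const 2).aestronglyMeasurable
    (ae_of_all _ fun p => ?_)
  rw [norm_pow]
  exact pow_le_pow_left₀ (norm_nonneg _) (hb p) 2

theorem integrable_w_mul (h : IsZeroDataSolution s T z w v W B) :
    Measurable (fun p => w p * z p) ∧ Integrable (fun p => w p * z p) ∧
      Integrable (fun p => (w p * z p) ^ 2) := by
  refine ⟨h.measurable_w.mul h.measurable_z, h.integrable.bdd_mul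
    h.measurable_w.aestronglyMeasurable (ae_of_all _ h.abs_w_le), ?_⟩
  simp only [mul_pow]
  refine h.integrable_sq.bdd_mul (c := W ^ 2) (h.measurable_w.pow_const 2).aestronglyMeasurable
    (ae_of_all _ fun p => ?_)
  rw [norm_pow]
  exact pow_le_pow_left₀ (norm_nonneg _) (h.abs_w_le p) 2

theorem integrable_fluxFourier (h : IsZeroDataSolution s T z w v W B) (ξ : RSpace d) :
    Integrable (fun t => fluxFourier s z w v t ξ) := by
  refine ((integrable_spaceFourier_left h.integrable_w_mul.1 h.integrable_w_mul.2.1 ξ).const_mul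
    _).add (Integrable.const_mul (integrable_finsetSum _ fun j _ => Integrable.const_mul ?_ _) _)
  exact integrable_spaceFourier_left (h.integrable_v_mul j).1 (h.integrable_v_mul j).2.1 ξ

theorem spaceFourier_eq_zero (h : IsZeroDataSolution s T z w v W B) {g : ℝ × RSpace d → ℝ}
    {t : ℝ} (ht : t ∉ Ioo 0 T) (ξ : RSpace d) :
    spaceFourier (fun p => g p * z p) t ξ = 0 := by
  simp [spaceFourier, fourier_eq_integral_planeWave, h.eq_zero t ht]

theorem integral_planeIntegrand_slice (h : IsZeroDataSolution s T z w v W B) (ψ : ℝ → ℝ)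
    (ξ : RSpace d) : ∀ᵐ t : ℝ, ∫ x, planeIntegrand s z w v ψ ξ (t, x) =
      ((deriv ψ t : ℝ) : ℂ) * spaceFourier z t ξ - ψ t * fluxFourier s z w v t ξ := by
  obtain ⟨h1, h2, h3⟩ := h.integrable_terms ξ
  have h4 := fun j => (h.integrable_v_mul j).2.1
  rw [Measure.volume_eq_prod] at h1 h2 h3
  simp only [Measure.volume_eq_prod] at h4
  filter_upwards [h1.prod_right_ae, h2.prod_right_ae, h3.prod_right_ae,
    ae_all_iff.2 fun j => (h4 j).prod_right_ae] with t e1 e2 e3 e4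
  simp only [planeIntegrand_eq]
  have e12 : Integrable (fun x => ((deriv ψ t : ℝ) : ℂ) * (planeWave ξ x * z (t, x)) -
      ψ t * (fracSymbol s ξ * (planeWave ξ x * ((w (t, x) : ℂ) * z (t, x))))) :=
    (e1.const_mul _).sub ((e2.const_mul _).const_mul _)
  rw [integral_add e12 (e3.const_mul _),
    integral_sub (e1.const_mul _) ((e2.const_mul _).const_mul _), integral_const_mul,
    integral_const_mul, integral_const_mul, integral_const_mul]
  have e5 : ∫ x, planeWave ξ x * (planePhase ξ (v (t, x)) * z (t, x)) =
      -(2 * Real.pi * Complex.I * ∑ j, (ξ j : ℂ) * spaceFourier (fun p => v p j * z p) t ξ) := by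
    have e6 : ∀ x, planeWave ξ x * (planePhase ξ (v (t, x)) * z (t, x)) =
        -(2 * Real.pi * Complex.I) * ∑ j, (ξ j : ℂ) *
          (planeWave ξ x * ((v (t, x) j * z (t, x) : ℝ) : ℂ)) := by
      intro x
      rw [planePhase_apply, PiLp.inner_apply]
      simp only [RCLike.inner_apply, conj_trivial]
      push_cast
      simp only [Finset.mul_sum, Finset.sum_mul]
      refine Finset.sum_congr rfl fun j _ => ?_
      ring
    have e7 : ∀ j, Integrable (fun x => planeWave ξ x * ((v (t, x) j * z (t, x) : ℝ) : ℂ)) := by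
      intro j
      refine (e4 j).ofReal.bdd_mul (c := 1)
        (contDiff_planeWave ξ).continuous.aestronglyMeasurable
        (ae_of_all _ fun x => (norm_planeWave ξ x).le)
    simp_rw [e6]
    rw [integral_const_mul, integral_finsetSum _ fun j _ => (e7 j).const_mul _, neg_mul]
    simp only [integral_const_mul, spaceFourier, fourier_eq_integral_planeWave]
  rw [e5, fluxFourier]
  simp only [spaceFourier, fourier_eq_integral_planeWave]
  push_cast
  ring

/-- Testing with `ψ(t)` times a plane wave says that `ẑ(·,ξ)` solves `a' = -F` weakly with `a(0) =
0`, where `F` is the flux transform. The exceptional set of times may depend on `ξ`. -/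
theorem ae_norm_spaceFourier_sq_eq (h : IsZeroDataSolution s T z w v W B) (hs : 0 ≤ s)
    (hs1 : s ≤ 1) (hT : 0 < T) (ξ : RSpace d) :
    ∀ᵐ t, t ∈ Ioo 0 T → ‖spaceFourier z t ξ‖ ^ 2 = ∫ τ in (0)..t,
      (-2 * ((starRingEnd ℂ) (spaceFourier z τ ξ) * fluxFourier s z w v τ ξ).re) := by
  have hF := h.integrable_fluxFourier ξ
  refine ae_normSq_eq_integral hF (ae_eq_neg_primitive_of_weak_complex hT
    (integrable_spaceFourier_left h.measurable_z h.integrable ξ) hF (fun t ht => ?_)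
    (fun t ht => ?_) fun ψ hψ hψc hψT => ?_)
  · simpa using h.spaceFourier_eq_zero (g := 1) ht ξ
  · simp [fluxFourier, h.spaceFourier_eq_zero ht ξ]
  · have h1 := h.integral_planeIntegrand hs hs1 hψ hψc hψT ξ
    have h2 := h.integrable_planeIntegrand hψ hψc ξ
    rw [Measure.volume_eq_prod] at h1 h2
    rw [integral_prod _ h2] at h1
    rw [← h1]
    refine integral_congr_ae ?_
    filter_upwards [h.integral_planeIntegrand_slice ψ ξ] with t ht
    exact ht.symm

end IsZeroDataSolution

/-! ### The energy inequality in `H^{-s}`. -/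

namespace IsZeroDataSolution

variable {d : ℕ} {s T : ℝ} {z w : ℝ × RSpace d → ℝ} {v : ℝ × RSpace d → RSpace d} {W B : ℝ}

theorem norm_sum_mul_le (ξ : RSpace d) (G : Fin d → ℂ) :
    ‖∑ j, (ξ j : ℂ) * G j‖ ≤ ‖ξ‖ * √(∑ j, ‖G j‖ ^ 2) := by
  refine (norm_sum_le _ _).trans ?_
  simp only [norm_mul, Complex.norm_real]
  rw [EuclideanSpace.norm_eq]
  exact Real.sum_mul_le_sqrt_mul_sqrt _ _ _

/-- For `s ≥ 1/2` the drift has order at most that of the diffusion, so dividing by `1 + q` makes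
its symbol bounded and the energy rate integrable. -/
theorem two_pi_norm_le {s : ℝ} (hs : 1 / 2 ≤ s) (ξ : RSpace d) :
    2 * Real.pi * ‖ξ‖ ≤ 1 + fracSymbol s ξ := by
  have h0 : 0 ≤ 2 * Real.pi * ‖ξ‖ := by positivity
  have h1 := fracSymbol_nonneg s ξ
  rcases le_total (2 * Real.pi * ‖ξ‖) 1 with h | h
  · linarith
  · have := Real.rpow_le_rpow_of_exponent_le h (by linarith : (1 : ℝ) ≤ 2 * s)
    rw [Real.rpow_one] at this
    unfold fracSymbol
    linarith

/-- The density, in frequency, of the dissipation of the energy `∫ ‖ẑ‖² / (1 + q)`. -/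
noncomputable def energyRate (s : ℝ) (z w : ℝ × RSpace d → ℝ) (v : ℝ × RSpace d → RSpace d)
    (t : ℝ) (ξ : RSpace d) : ℝ :=
  -2 * ((starRingEnd ℂ) (spaceFourier z t ξ) * fluxFourier s z w v t ξ).re / (1 + fracSymbol s ξ)

theorem abs_rate_le {s : ℝ} (hs : 1 / 2 ≤ s) (ξ : RSpace d) (a g : ℂ) (G : Fin d → ℂ) :
    |-2 * ((starRingEnd ℂ) a * (fracSymbol s ξ * g +
      2 * Real.pi * Complex.I * ∑ j, (ξ j : ℂ) * G j)).re / (1 + fracSymbol s ξ)| ≤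
      2 * ‖a‖ ^ 2 + ‖g‖ ^ 2 + ∑ j, ‖G j‖ ^ 2 := by
  have hq := fracSymbol_nonneg s ξ
  have hr := two_pi_norm_le hs ξ
  set Γ := √(∑ j, ‖G j‖ ^ 2) with hΓ
  have hΓ2 : Γ ^ 2 = ∑ j, ‖G j‖ ^ 2 := Real.sq_sqrt (Finset.sum_nonneg fun j _ => sq_nonneg _)
  have hΓ0 : 0 ≤ Γ := Real.sqrt_nonneg _
  have h1 : ‖(fracSymbol s ξ * g + 2 * Real.pi * Complex.I * ∑ j, (ξ j : ℂ) * G j : ℂ)‖ ≤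
      (1 + fracSymbol s ξ) * (‖g‖ + Γ) := by
    refine (norm_add_le _ _).trans ?_
    rw [norm_mul, Complex.norm_real, Real.norm_of_nonneg hq, norm_mul]
    have h2 : ‖(2 * Real.pi * Complex.I : ℂ)‖ = 2 * Real.pi := by
      simp [abs_of_pos Real.pi_pos]
    rw [h2]
    have h3 := mul_le_mul_of_nonneg_left (norm_sum_mul_le ξ G) Real.two_pi_pos.le
    have h4 := mul_le_mul_of_nonneg_right hr hΓ0
    nlinarith [norm_nonneg g]
  rw [abs_div, abs_of_pos (by linarith : 0 < 1 + fracSymbol s ξ), div_le_iff₀ (by linarith),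
    abs_mul, abs_neg, abs_two]
  have h5 := Complex.abs_re_le_norm ((starRingEnd ℂ) a * (fracSymbol s ξ * g +
      2 * Real.pi * Complex.I * ∑ j, (ξ j : ℂ) * G j))
  rw [norm_mul, RCLike.norm_conj] at h5
  have h6 := mul_le_mul_of_nonneg_left h1 (norm_nonneg a)
  have h7 : 2 * (‖a‖ * (‖g‖ + Γ)) ≤ 2 * ‖a‖ ^ 2 + ‖g‖ ^ 2 + Γ ^ 2 := by
    nlinarith [sq_nonneg (‖a‖ - ‖g‖), sq_nonneg (‖a‖ - Γ)]
  rw [← hΓ2]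
  nlinarith [mul_le_mul_of_nonneg_left h7 (by linarith : 0 ≤ 1 + fracSymbol s ξ)]

/-- With `Q = 1/(1+q)` one has `qQ = 1 - Q`. The `1` gives the leading term, whose integral is `-2 ∫
w z²`; the `Q` part is split by Young's inequality with weight `W`. Terms carrying `Q ‖a‖²` become
energy, and the other positive terms are absorbed by the leading one after integration. -/
theorem rate_le {s : ℝ} {k₁ k₂ K W : ℝ} (hk₁ : 0 ≤ k₁) (hk₂ : 0 ≤ k₂) (hK : 0 ≤ K) (hW : 0 < W)
    (ξ : RSpace d) (a g : ℂ) (G : Fin d → ℂ)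
    (h : (∀ j, G j = 0) ∨ (2 * Real.pi * ‖ξ‖) ^ 2 / (1 + fracSymbol s ξ) ^ 2 ≤
      k₁ * (k₂ + K / (1 + fracSymbol s ξ))) :
    -2 * ((starRingEnd ℂ) a * (fracSymbol s ξ * g +
      2 * Real.pi * Complex.I * ∑ j, (ξ j : ℂ) * G j)).re / (1 + fracSymbol s ξ) ≤
      -2 * ((starRingEnd ℂ) a * g).re + (W + K) * (‖a‖ ^ 2 / (1 + fracSymbol s ξ)) +
      W⁻¹ * ‖g‖ ^ 2 + k₁ * ∑ j, ‖G j‖ ^ 2 + k₂ * ‖a‖ ^ 2 := by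
  have hq := fracSymbol_nonneg s ξ
  have hq1 : 0 < 1 + fracSymbol s ξ := by linarith
  obtain ⟨Q, hQ⟩ : ∃ Q, Q = (1 + fracSymbol s ξ)⁻¹ := ⟨_, rfl⟩
  have hQ0 : 0 ≤ Q := by rw [hQ]; positivity
  have hQ1 : Q ≤ 1 := by rw [hQ]; exact inv_le_one_of_one_le₀ (by linarith)
  have hQq : fracSymbol s ξ * Q = 1 - Q := by
    rw [hQ]
    field_simp
    ring
  set S := ∑ j, (ξ j : ℂ) * G j with hS
  set Γ := √(∑ j, ‖G j‖ ^ 2) with hΓ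
  have hΓ2 : Γ ^ 2 = ∑ j, ‖G j‖ ^ 2 := Real.sq_sqrt (Finset.sum_nonneg fun j _ => sq_nonneg _)
  have hΓ0 : 0 ≤ Γ := Real.sqrt_nonneg _
  have e1 : ((starRingEnd ℂ) a * (fracSymbol s ξ * g + 2 * Real.pi * Complex.I * S)).re =
      fracSymbol s ξ * ((starRingEnd ℂ) a * g).re +
      2 * Real.pi * ((starRingEnd ℂ) a * (Complex.I * S)).re := by
    have : (starRingEnd ℂ) a * (fracSymbol s ξ * g + 2 * Real.pi * Complex.I * S) =
        ((fracSymbol s ξ : ℝ) : ℂ) * ((starRingEnd ℂ) a * g) +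
        ((2 * Real.pi : ℝ) : ℂ) * ((starRingEnd ℂ) a * (Complex.I * S)) := by
      push_cast
      ring
    rw [this, Complex.add_re, Complex.re_ofReal_mul, Complex.re_ofReal_mul]
  have e2 : |((starRingEnd ℂ) a * g).re| ≤ ‖a‖ * ‖g‖ := by
    refine (Complex.abs_re_le_norm _).trans (le_of_eq ?_)
    rw [norm_mul, RCLike.norm_conj]
  have e3 : 2 * ((starRingEnd ℂ) a * g).re * Q ≤ W * (‖a‖ ^ 2 * Q) + W⁻¹ * ‖g‖ ^ 2 := by
    have h1 : 2 * (‖a‖ * ‖g‖) ≤ W * ‖a‖ ^ 2 + W⁻¹ * ‖g‖ ^ 2 := by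
      have h2 : W * ‖a‖ ^ 2 + W⁻¹ * ‖g‖ ^ 2 - 2 * (‖a‖ * ‖g‖) = W⁻¹ * (W * ‖a‖ - ‖g‖) ^ 2 := by
        field_simp
        ring
      have h3 : 0 ≤ W⁻¹ * (W * ‖a‖ - ‖g‖) ^ 2 := by positivity
      linarith
    have h2 : 2 * ((starRingEnd ℂ) a * g).re ≤ W * ‖a‖ ^ 2 + W⁻¹ * ‖g‖ ^ 2 := by
      linarith [le_abs_self ((starRingEnd ℂ) a * g).re]
    have h3 := mul_le_mul_of_nonneg_right h2 hQ0
    have h4 : W⁻¹ * ‖g‖ ^ 2 * Q ≤ W⁻¹ * ‖g‖ ^ 2 := mul_le_of_le_one_right (by positivity) hQ1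
    linarith
  have e4 : -2 * (2 * Real.pi * ((starRingEnd ℂ) a * (Complex.I * S)).re) * Q ≤
      k₁ * Γ ^ 2 + (k₂ + K * Q) * ‖a‖ ^ 2 := by
    have hRHS : 0 ≤ k₁ * Γ ^ 2 + (k₂ + K * Q) * ‖a‖ ^ 2 := by positivity
    rcases h with h | h
    · have : S = 0 := by simp [hS, h]
      rw [this]
      simpa using hRHS
    · have h1 : |((starRingEnd ℂ) a * (Complex.I * S)).re| ≤ ‖a‖ * (‖ξ‖ * Γ) := by
        refine (Complex.abs_re_le_norm _).trans ?_
        rw [norm_mul, RCLike.norm_conj, norm_mul, Complex.norm_I, one_mul]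
        exact mul_le_mul_of_nonneg_left (norm_sum_mul_le ξ G) (norm_nonneg _)
      have h2 : -2 * (2 * Real.pi * ((starRingEnd ℂ) a * (Complex.I * S)).re) * Q ≤
          2 * (‖a‖ * (2 * Real.pi * ‖ξ‖ * Q) * Γ) := by
        have h3 := neg_le_abs ((starRingEnd ℂ) a * (Complex.I * S)).re
        have h4 := mul_le_mul_of_nonneg_left (h3.trans h1)
          (by positivity : 0 ≤ 2 * (2 * Real.pi) * Q)
        linarith
      -- Squares are compared: the drift hypothesis reduces the claim to `4XY ≤ (X + Y)²` with `X =
      -- k₁ Γ²` and `Y = (k₂ + K Q) ‖a‖²`.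
      refine h2.trans (abs_le_of_sq_le_sq' ?_ hRHS).2
      have h5 : (2 * Real.pi * ‖ξ‖ * Q) ^ 2 ≤ k₁ * (k₂ + K * Q) := by
        rw [div_eq_mul_inv, div_eq_mul_inv, ← inv_pow, ← hQ, ← mul_pow] at h
        exact h
      have h6 := mul_le_mul_of_nonneg_left h5 (by positivity : 0 ≤ 4 * ‖a‖ ^ 2 * Γ ^ 2)
      have h7 := sq_nonneg (k₁ * Γ ^ 2 - (k₂ + K * Q) * ‖a‖ ^ 2)
      nlinarith
  rw [e1, div_eq_mul_inv, div_eq_mul_inv, ← hQ, ← hΓ2]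
  have e5 : -2 * (fracSymbol s ξ * ((starRingEnd ℂ) a * g).re +
      2 * Real.pi * ((starRingEnd ℂ) a * (Complex.I * S)).re) * Q =
      -2 * ((starRingEnd ℂ) a * g).re + 2 * ((starRingEnd ℂ) a * g).re * Q +
      -2 * (2 * Real.pi * ((starRingEnd ℂ) a * (Complex.I * S)).re) * Q := by
    linear_combination (-2 * ((starRingEnd ℂ) a * g).re) * hQq
  rw [e5]
  linarith

theorem measurable_fluxFourier (h : IsZeroDataSolution s T z w v W B) (hs : 0 ≤ s) :
    Measurable (fun p : ℝ × RSpace d => fluxFourier s z w v p.1 p.2) := by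
  have h1 : Measurable (fun p : ℝ × RSpace d => (fracSymbol s p.2 : ℂ)) :=
    Complex.measurable_ofReal.comp ((continuous_fracSymbol d hs).measurable.comp measurable_snd)
  have h2 := (stronglyMeasurable_spaceFourier h.integrable_w_mul.1).measurable
  have h3 := fun j => (stronglyMeasurable_spaceFourier (h.integrable_v_mul j).1).measurable
  have h4 : ∀ j, Measurable (fun p : ℝ × RSpace d => (p.2 j : ℂ)) := fun j =>
    Complex.measurable_ofReal.comp
      ((EuclideanSpace.proj (𝕜 := ℝ) j).continuous.measurable.comp measurable_snd)
  exact (h1.mul h2).add ((Finset.measurable_fun_sum _ fun j _ => (h4 j).mul (h3 j)).const_mul _)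

theorem measurable_energyRate (h : IsZeroDataSolution s T z w v W B) (hs : 0 ≤ s) :
    Measurable (fun p : ℝ × RSpace d => energyRate s z w v p.1 p.2) := by
  have h1 := (stronglyMeasurable_spaceFourier h.measurable_z).measurable
  have h2 : Measurable (fun p : ℝ × RSpace d => 1 + fracSymbol s p.2) :=
    ((continuous_fracSymbol d hs).measurable.comp measurable_snd).const_add 1
  have h3 : Measurable (fun p : ℝ × RSpace d => (starRingEnd ℂ) (spaceFourier z p.1 p.2)) :=
    Complex.continuous_conj.measurable.comp h1
  exact ((Complex.measurable_re.comp (h3.mul (h.measurable_fluxFourier hs))).const_mul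
    (-2 : ℝ)).div h2

theorem integrable_energyRate (h : IsZeroDataSolution s T z w v W B) (hs : 1 / 2 ≤ s) :
    Integrable (fun p : ℝ × RSpace d => energyRate s z w v p.1 p.2) := by
  refine ((((integrable_norm_spaceFourier_sq h.measurable_z h.integrable
    h.integrable_sq).const_mul 2).add (integrable_norm_spaceFourier_sq h.integrable_w_mul.1
    h.integrable_w_mul.2.1 h.integrable_w_mul.2.2)).add (integrable_finsetSum Finset.univ
    fun j _ => integrable_norm_spaceFourier_sq (h.integrable_v_mul j).1
    (h.integrable_v_mul j).2.1 (h.integrable_v_mul j).2.2)).mono'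
    (h.measurable_energyRate (by linarith)).aestronglyMeasurable (ae_of_all _ fun p => ?_)
  exact abs_rate_le hs p.2 _ _ _

/-- The `H^{-s}` energy of the solution. -/
noncomputable def energy (s : ℝ) (z : ℝ × RSpace d → ℝ) (t : ℝ) : ℝ :=
  ∫ ξ, ‖spaceFourier z t ξ‖ ^ 2 / (1 + fracSymbol s ξ)

theorem integrable_energyDensity (h : IsZeroDataSolution s T z w v W B) (hs : 0 ≤ s) :
    Integrable (fun p : ℝ × RSpace d => ‖spaceFourier z p.1 p.2‖ ^ 2 / (1 + fracSymbol s p.2)) := by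
  refine (integrable_norm_spaceFourier_sq h.measurable_z h.integrable h.integrable_sq).mono'
    ?_ (ae_of_all _ fun p => ?_)
  · have h2 : Measurable (fun p : ℝ × RSpace d => 1 + fracSymbol s p.2) :=
      ((continuous_fracSymbol d hs).measurable.comp measurable_snd).const_add 1
    exact (((stronglyMeasurable_spaceFourier h.measurable_z).measurable.norm.pow_const 2).div
      h2).aestronglyMeasurable
  · have := fracSymbol_nonneg s p.2
    rw [Real.norm_of_nonneg (by positivity)]
    exact div_le_self (by positivity) (by linarith)

/-- Plancherel turns everything but the energy term into `∫ (-2w + W⁻¹ w² + k₁ ‖v‖² + k₂) z²`. This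
is nonpositive: `0 ≤ w ≤ W` gives `W⁻¹ w² ≤ w`, and `hw` bounds the rest by `w`. -/
theorem integral_energyRate_le (h : IsZeroDataSolution s T z w v W B) (hs : 1 / 2 ≤ s)
    {k₁ k₂ K : ℝ} (hk₁ : 0 ≤ k₁) (hk₂ : 0 ≤ k₂) (hK : 0 ≤ K) (hW : 0 < W)
    (hcond : (∀ p, v p = 0) ∨ ∀ ξ : RSpace d, (2 * Real.pi * ‖ξ‖) ^ 2 / (1 + fracSymbol s ξ) ^ 2 ≤
      k₁ * (k₂ + K / (1 + fracSymbol s ξ)))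
    (hw : ∀ p, k₁ * ‖v p‖ ^ 2 + k₂ ≤ w p) :
    ∀ᵐ t : ℝ, ∫ ξ, energyRate s z w v t ξ ≤ (W + K) * energy s z t := by
  have hE := h.integrable_energyRate hs
  have hD := h.integrable_energyDensity (by linarith : 0 ≤ s)
  rw [Measure.volume_eq_prod] at hE hD
  filter_upwards [ae_integrable_slices h.measurable_z h.integrable h.integrable_sq,
    ae_integrable_slices h.integrable_w_mul.1 h.integrable_w_mul.2.1 h.integrable_w_mul.2.2,
    ae_all_iff.2 fun j => ae_integrable_slices (h.integrable_v_mul j).1 (h.integrable_v_mul j).2.1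
      (h.integrable_v_mul j).2.2, hE.prod_right_ae, hD.prod_right_ae] with t hz hwz hvz hEt hDt
  obtain ⟨-, i1, p1⟩ := integral_conj_fourier_mul_fourier hz.1 hz.2 hwz.1 hwz.2
  obtain ⟨i2, p2⟩ := integral_norm_fourier_sq hz.1 hz.2
  obtain ⟨i3, p3⟩ := integral_norm_fourier_sq hwz.1 hwz.2
  have i4 := fun j => (integral_norm_fourier_sq (hvz j).1 (hvz j).2).1
  have p4 := fun j => (integral_norm_fourier_sq (hvz j).1 (hvz j).2).2
  have j1 : Integrable (fun ξ => -2 * ((starRingEnd ℂ) (spaceFourier z t ξ) *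
      spaceFourier (fun p => w p * z p) t ξ).re) := i1.const_mul _
  have j2 : Integrable (fun ξ => (W + K) * (‖spaceFourier z t ξ‖ ^ 2 / (1 + fracSymbol s ξ))) :=
    hDt.const_mul _
  have j3 : Integrable (fun ξ => W⁻¹ * ‖spaceFourier (fun p => w p * z p) t ξ‖ ^ 2) :=
    i3.const_mul _
  have j4' : ∀ j, Integrable (fun ξ => ‖spaceFourier (fun p => v p j * z p) t ξ‖ ^ 2) :=
    fun j => i4 j
  have j4 : Integrable (fun ξ => k₁ * ∑ j, ‖spaceFourier (fun p => v p j * z p) t ξ‖ ^ 2) :=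
    (integrable_finsetSum _ fun j _ => j4' j).const_mul _
  have j5 : Integrable (fun ξ => k₂ * ‖spaceFourier z t ξ‖ ^ 2) := i2.const_mul _
  have j12 := j1.add j2
  have j123 := j12.add j3
  have j1234 := j123.add j4
  have hbound : ∫ ξ, energyRate s z w v t ξ ≤ ∫ ξ, (-2 * ((starRingEnd ℂ) (spaceFourier z t ξ) *
      spaceFourier (fun p => w p * z p) t ξ).re +
      (W + K) * (‖spaceFourier z t ξ‖ ^ 2 / (1 + fracSymbol s ξ)) +
      W⁻¹ * ‖spaceFourier (fun p => w p * z p) t ξ‖ ^ 2 +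
      k₁ * ∑ j, ‖spaceFourier (fun p => v p j * z p) t ξ‖ ^ 2 +
      k₂ * ‖spaceFourier z t ξ‖ ^ 2) := by
    refine integral_mono hEt (j1234.add j5) fun ξ => ?_
    refine rate_le hk₁ hk₂ hK hW ξ _ _ _ (hcond.imp (fun h0 j => ?_) fun h0 => h0 ξ)
    simp [spaceFourier, fourier_eq_integral_planeWave, h0]
  refine hbound.trans ?_
  have hsum : ∫ ξ, (-2 * ((starRingEnd ℂ) (spaceFourier z t ξ) *
      spaceFourier (fun p => w p * z p) t ξ).re +
      (W + K) * (‖spaceFourier z t ξ‖ ^ 2 / (1 + fracSymbol s ξ)) +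
      W⁻¹ * ‖spaceFourier (fun p => w p * z p) t ξ‖ ^ 2 +
      k₁ * ∑ j, ‖spaceFourier (fun p => v p j * z p) t ξ‖ ^ 2 +
      k₂ * ‖spaceFourier z t ξ‖ ^ 2) = -2 * (∫ x, z (t, x) * (w (t, x) * z (t, x))) +
      (W + K) * energy s z t + W⁻¹ * (∫ x, (w (t, x) * z (t, x)) ^ 2) +
      k₁ * ∑ j, (∫ x, (v (t, x) j * z (t, x)) ^ 2) + k₂ * ∫ x, z (t, x) ^ 2 := by
    rw [integral_add (by exact j1234) j5, integral_add (by exact j123) j4,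
      integral_add (by exact j12) j3, integral_add j1 j2, integral_const_mul, integral_const_mul,
      integral_const_mul, integral_const_mul, integral_const_mul,
      integral_finsetSum _ fun j _ => j4' j]
    simp only [energy, ← p1, ← p2, ← p3, ← p4, spaceFourier]
  rw [hsum]
  have z2 : Integrable (fun x => z (t, x) ^ 2) := hz.2.integrable_sq
  have w2 : Integrable (fun x => (w (t, x) * z (t, x)) ^ 2) := hwz.2.integrable_sq
  have v2 : ∀ j, Integrable (fun x => (v (t, x) j * z (t, x)) ^ 2) := fun j =>
    (hvz j).2.integrable_sq
  have zw : Integrable (fun x => z (t, x) * (w (t, x) * z (t, x))) := by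
    exact hz.2.integrable_mul hwz.2
  have hfin : -2 * (∫ x, z (t, x) * (w (t, x) * z (t, x))) +
      W⁻¹ * (∫ x, (w (t, x) * z (t, x)) ^ 2) +
      k₁ * ∑ j, (∫ x, (v (t, x) j * z (t, x)) ^ 2) + k₂ * ∫ x, z (t, x) ^ 2 ≤ 0 := by
    rw [← integral_finsetSum _ fun j _ => v2 j, ← integral_const_mul, ← integral_const_mul,
      ← integral_const_mul, ← integral_const_mul]
    have a1 := zw.const_mul (-2)
    have a2 := w2.const_mul W⁻¹
    have a3 := (integrable_finsetSum Finset.univ fun j _ => v2 j).const_mul k₁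
    rw [← integral_add a1 a2, ← integral_add (by exact a1.add a2) a3,
      ← integral_add (by exact (a1.add a2).add a3) (z2.const_mul k₂)]
    refine integral_nonpos fun x => ?_
    simp only [Pi.zero_apply, mul_pow, ← Finset.sum_mul]
    have b1 := EuclideanSpace.real_norm_sq_eq (v (t, x))
    rw [← b1]
    have b2 := hw (t, x)
    have b3 : W⁻¹ * w (t, x) ^ 2 ≤ w (t, x) := by
      rw [inv_mul_le_iff₀ hW, sq]
      exact mul_le_mul_of_nonneg_right (h.w_le _) (h.w_nonneg _)
    nlinarith [sq_nonneg (z (t, x)), mul_le_mul_of_nonneg_right b2 (sq_nonneg (z (t, x))),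
      mul_le_mul_of_nonneg_right b3 (sq_nonneg (z (t, x)))]
  linarith

end IsZeroDataSolution

/-! ### Integration over frequencies and uniqueness with zero datum. -/

namespace IsZeroDataSolution

variable {d : ℕ} {s T : ℝ} {z w : ℝ × RSpace d → ℝ} {v : ℝ × RSpace d → RSpace d} {W B : ℝ}

/-- Exchanges "for every `ξ`, almost every `t`" into "for almost every `t`, almost every `ξ`", as
integration in `ξ` at fixed time requires. Writing the time integral with an indicator makes it
jointly measurable in `(t, ξ)`. -/
theorem ae_ae_energyDensity_eq (h : IsZeroDataSolution s T z w v W B) (hs : 0 ≤ s)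
    (hs1 : s ≤ 1) (hT : 0 < T) :
    ∀ᵐ t : ℝ, ∀ᵐ ξ : RSpace d, t ∈ Ioo 0 T →
      ‖spaceFourier z t ξ‖ ^ 2 / (1 + fracSymbol s ξ) =
        ∫ τ, (Ioc 0 t).indicator (fun τ => energyRate s z w v τ ξ) τ := by
  have hR : Measurable (fun p : ℝ × RSpace d =>
      ∫ τ, (Ioc 0 p.1).indicator (fun τ => energyRate s z w v τ p.2) τ) := by
    have h1 : Measurable (fun q : (ℝ × RSpace d) × ℝ => energyRate s z w v q.2 q.1.2) := by
      have h0 := h.measurable_energyRate hs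
      obtain ⟨e, he⟩ : ∃ e : ℝ × RSpace d → ℝ, e = fun p => energyRate s z w v p.1 p.2 := ⟨_, rfl⟩
      rw [← he] at h0
      have h2 : Measurable (fun q : (ℝ × RSpace d) × ℝ => e (q.2, q.1.2)) :=
        h0.comp (by fun_prop)
      rwa [he] at h2
    have h2 : MeasurableSet {q : (ℝ × RSpace d) × ℝ | 0 < q.2 ∧ q.2 ≤ q.1.1} :=
      (measurableSet_lt measurable_const measurable_snd).inter
        (measurableSet_le measurable_snd measurable_fst.fst)
    exact (h1.indicator h2).stronglyMeasurable.integral_prod_right'.measurable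
  have hL : Measurable (fun p : ℝ × RSpace d =>
      ‖spaceFourier z p.1 p.2‖ ^ 2 / (1 + fracSymbol s p.2)) :=
    ((stronglyMeasurable_spaceFourier h.measurable_z).measurable.norm.pow_const 2).div
      (((continuous_fracSymbol d hs).measurable.comp measurable_snd).const_add 1)
  have hmeas : MeasurableSet {p : ℝ × RSpace d | p.1 ∈ Ioo 0 T →
      ‖spaceFourier z p.1 p.2‖ ^ 2 / (1 + fracSymbol s p.2) =
        ∫ τ, (Ioc 0 p.1).indicator (fun τ => energyRate s z w v τ p.2) τ} :=
    MeasurableSet.imp (measurable_fst measurableSet_Ioo) (measurableSet_eq_fun hL hR)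
  refine (Measure.ae_ae_comm (p := fun t ξ => t ∈ Ioo 0 T →
      ‖spaceFourier z t ξ‖ ^ 2 / (1 + fracSymbol s ξ) =
        ∫ τ, (Ioc 0 t).indicator (fun τ => energyRate s z w v τ ξ) τ) hmeas).2
    (ae_of_all _ fun ξ => ?_)
  filter_upwards [h.ae_norm_spaceFourier_sq_eq hs hs1 hT ξ] with t ht htT
  rw [ht htT, integral_indicator measurableSet_Ioc, intervalIntegral.integral_of_le htT.1.le,
    ← integral_div]
  rfl

theorem ae_energy_eq (h : IsZeroDataSolution s T z w v W B) (hs : 1 / 2 ≤ s)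
    (hs1 : s ≤ 1) (hT : 0 < T) :
    ∀ᵐ t : ℝ, t ∈ Ioo 0 T →
      energy s z t = ∫ τ in (0)..t, ∫ ξ, energyRate s z w v τ ξ := by
  have hE := h.integrable_energyRate hs
  filter_upwards [h.ae_ae_energyDensity_eq (by linarith) hs1 hT] with t ht htT
  have hEt : Integrable (fun p : ℝ × RSpace d => energyRate s z w v p.1 p.2)
      ((volume.restrict (Ioc 0 t)).prod volume) := by
    rw [← Measure.restrict_univ (μ := (volume : Measure (RSpace d))), Measure.prod_restrict,
      ← Measure.volume_eq_prod]
    exact hE.integrableOn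
  rw [intervalIntegral.integral_of_le htT.1.le, integral_integral_swap hEt, energy]
  refine integral_congr_ae ?_
  filter_upwards [ht] with ξ hξ
  rw [hξ htT, integral_indicator measurableSet_Ioc]

/-- Uniqueness for the linear equation with zero initial datum. -/
theorem ae_eq_zero (h : IsZeroDataSolution s T z w v W B) (hs : 1 / 2 ≤ s) (hs1 : s ≤ 1)
    (hT : 0 < T) {k₁ k₂ K : ℝ} (hk₁ : 0 ≤ k₁) (hk₂ : 0 ≤ k₂) (hK : 0 ≤ K) (hW : 0 < W)
    (hcond : (∀ p, v p = 0) ∨ ∀ ξ : RSpace d, (2 * Real.pi * ‖ξ‖) ^ 2 / (1 + fracSymbol s ξ) ^ 2 ≤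
      k₁ * (k₂ + K / (1 + fracSymbol s ξ)))
    (hw : ∀ p, k₁ * ‖v p‖ ^ 2 + k₂ ≤ w p) : z =ᵐ[volume] 0 := by
  have hE := h.integrable_energyRate hs
  have hD := h.integrable_energyDensity (by linarith : 0 ≤ s)
  rw [Measure.volume_eq_prod] at hE hD
  have hen : Integrable (energy s z) := hD.integral_prod_left
  have hrate : Integrable (fun t => ∫ ξ, energyRate s z w v t ξ) := hE.integral_prod_left
  have hdn : ∀ t ξ, 0 ≤ ‖spaceFourier z t ξ‖ ^ 2 / (1 + fracSymbol s ξ) := fun t ξ => by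
    have := fracSymbol_nonneg s ξ
    positivity
  have h0 : ∀ᵐ t : ℝ, t ∈ Ioo 0 T → energy s z t = 0 := by
    refine ae_eq_zero_of_le_integral (by positivity : 0 ≤ W + K) hen
      (fun t => integral_nonneg (hdn t)) ?_
    filter_upwards [h.ae_energy_eq hs hs1 hT] with t ht htT
    rw [ht htT, ← intervalIntegral.integral_const_mul]
    refine intervalIntegral.integral_mono_ae htT.1.le hrate.intervalIntegrable
      (hen.const_mul _).intervalIntegrable ?_
    exact h.integral_energyRate_le hs hk₁ hk₂ hK hW hcond hw
  -- The weight `1/(1+q)` is positive, so zero energy forces `ẑ(t,·) = 0` almost everywhere, and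
  -- Plancherel returns to `z`.
  have h1 : ∀ᵐ t : ℝ, ∫ x, z (t, x) ^ 2 = 0 := by
    filter_upwards [h0, hD.prod_right_ae,
      ae_integrable_slices h.measurable_z h.integrable h.integrable_sq] with t ht hDt hzt
    by_cases htT : t ∈ Ioo 0 T
    · rw [← (integral_norm_fourier_sq hzt.1 hzt.2).2]
      refine integral_eq_zero_of_ae ?_
      have h2 := (integral_eq_zero_iff_of_nonneg (hdn t) hDt).1 (ht htT)
      filter_upwards [h2] with ξ hξ
      have := fracSymbol_nonneg s ξ
      simp only [Pi.zero_apply, div_eq_zero_iff] at hξ ⊢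
      exact hξ.resolve_right (by linarith)
    · simp [h.eq_zero t htT]
  have h2 : ∫ p, z p ^ 2 = 0 := by
    have h3 := h.integrable_sq
    rw [Measure.volume_eq_prod] at h3 ⊢
    rw [integral_prod _ h3]
    exact integral_eq_zero_of_ae h1
  have h3 := (integral_eq_zero_iff_of_nonneg (fun p => sq_nonneg (z p)) h.integrable_sq).1 h2
  filter_upwards [h3] with p hp
  simpa using hp

end IsZeroDataSolution

/-! ### Bounds on the drift symbol and on the coefficients. -/

/-- For `s > 1/2`, the drift symbol is controlled by a small constant up to a multiple of the
energy weight. -/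
theorem exists_drift_symbol_le {s : ℝ} (hs : 1 / 2 < s) {η : ℝ} (hη : 0 < η) :
    ∃ C : ℝ, 0 ≤ C ∧ ∀ (d : ℕ) (ξ : RSpace d),
      (2 * Real.pi * ‖ξ‖) ^ 2 / (1 + fracSymbol s ξ) ^ 2 ≤ η + C / (1 + fracSymbol s ξ) := by
  have h1 : Tendsto (fun r : ℝ => r ^ (-(4 * s - 2))) atTop (𝓝 0) :=
    tendsto_rpow_neg_atTop (by linarith)
  -- Beyond radius `R` the symbol is at most `r^(2-4s) ≤ η`, the exponent being negative as `s >
  -- 1/2`. Below `R` the numerator is at most `R²`, whence `C = R²`.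
  obtain ⟨R, hR1, hR⟩ := ((eventually_ge_atTop (1 : ℝ)).and (h1.eventually_le_const hη)).exists
  refine ⟨R ^ 2, sq_nonneg _, fun d ξ => ?_⟩
  have hq := fracSymbol_nonneg s ξ
  have hr : 0 ≤ 2 * Real.pi * ‖ξ‖ := by positivity
  set r := 2 * Real.pi * ‖ξ‖ with hrdef
  rcases le_total r R with h | h
  · have h2 : r ^ 2 / (1 + fracSymbol s ξ) ^ 2 ≤ R ^ 2 / (1 + fracSymbol s ξ) := by
      refine div_le_div₀ (sq_nonneg _) (pow_le_pow_left₀ hr h 2) (by linarith) ?_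
      nlinarith
    linarith
  · have hr0 : 0 < r := by linarith
    have h2 : r ^ 2 / (1 + fracSymbol s ξ) ^ 2 ≤ r ^ 2 / (r ^ (2 * s)) ^ 2 := by
      have h3 : 0 < r ^ (2 * s) := Real.rpow_pos_of_pos hr0 _
      refine div_le_div_of_nonneg_left (sq_nonneg _) (by positivity)
        (pow_le_pow_left₀ h3.le ?_ 2)
      simp only [fracSymbol, ← hrdef]
      linarith
    have h3 : r ^ 2 / (r ^ (2 * s)) ^ 2 = r ^ (-(4 * s - 2)) := by
      rw [← Real.rpow_natCast, ← Real.rpow_natCast, ← Real.rpow_mul hr, ← Real.rpow_sub hr0]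
      congr 1
      push_cast
      ring
    have h4 : r ^ (-(4 * s - 2)) ≤ R ^ (-(4 * s - 2)) :=
      Real.rpow_le_rpow_of_nonpos (by linarith) h (by linarith)
    have h5 : 0 ≤ R ^ 2 / (1 + fracSymbol s ξ) := by positivity
    linarith

theorem exists_bounded_measurable_rep {X E : Type*} [MeasurableSpace X] [NormedAddCommGroup E]
    [MeasurableSpace E] [BorelSpace E] {μ : Measure X} {f : X → E}
    (hf : MemLp f ⊤ μ) : ∃ (g : X → E) (M : ℝ), 0 ≤ M ∧ Measurable g ∧ (∀ x, ‖g x‖ ≤ M) ∧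
      f =ᵐ[μ] g := by
  obtain ⟨M, hM⟩ : ∃ M : ℝ, ∀ᵐ x ∂μ, ‖f x‖ ≤ M :=
    ⟨_, ae_le_lpNorm_exponent_top hf⟩
  set g₀ := hf.1.mk f with hg₀
  have hg₀m : Measurable g₀ := hf.1.stronglyMeasurable_mk.measurable
  refine ⟨{x | ‖g₀ x‖ ≤ |M|}.indicator g₀, |M|, abs_nonneg _,
    hg₀m.indicator (measurableSet_le hg₀m.norm measurable_const), fun x => ?_, ?_⟩
  · by_cases hx : ‖g₀ x‖ ≤ |M|
    · rwa [indicator_of_mem (by exact hx)]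
    · rw [indicator_of_notMem (by exact hx), norm_zero]
      exact abs_nonneg _
  · filter_upwards [hM, hf.1.ae_eq_mk] with x h1 h2
    rw [indicator_of_mem, h2]
    change ‖g₀ x‖ ≤ |M|
    rw [hg₀, ← h2]
    exact h1.trans (le_abs_self M)

theorem measurable_quot {β : ℝ → ℝ} (hβ : Continuous β) (κ : ℝ) : Measurable (quot β κ) :=
  Measurable.ite (measurableSet_singleton 0) measurable_const (hβ.measurable.div measurable_id)

/-- As `β 0 = 0`, the quotient is a slope from the origin and the mean value theorem applies. Bounds
on `β'` over `[-M, M]` thus pass to the quotient, except at `r = 0`, where `κ` has to be bounded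
separately. -/
theorem quot_eq_deriv {β : ℝ → ℝ} (hβ : ContDiff ℝ 1 β) (hβ0 : β 0 = 0) (κ : ℝ) {M r : ℝ}
    (hr : |r| ≤ M) (hr0 : r ≠ 0) : ∃ c ∈ Icc (-M) M, quot β κ r = deriv β c := by
  have hd : Differentiable ℝ β := hβ.differentiable one_ne_zero
  obtain ⟨h1, h2⟩ := abs_le.1 hr
  rw [quot, if_neg hr0]
  rcases lt_or_gt_of_ne hr0 with h | h
  · obtain ⟨c, hc, hc'⟩ := exists_deriv_eq_slope β h hβ.continuous.continuousOn
      hd.differentiableOn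
    refine ⟨c, ⟨h1.trans hc.1.le, hc.2.le.trans (by linarith)⟩, ?_⟩
    rw [hc', hβ0, zero_sub, zero_sub, neg_div_neg_eq]
  · obtain ⟨c, hc, hc'⟩ := exists_deriv_eq_slope β h hβ.continuous.continuousOn
      hd.differentiableOn
    refine ⟨c, ⟨by linarith [hc.1], hc.2.le.trans h2⟩, ?_⟩
    rw [hc', hβ0, sub_zero, sub_zero]

theorem exists_quot_le {β : ℝ → ℝ} (hβ : ContDiff ℝ 1 β) (hβ0 : β 0 = 0) (κ M : ℝ) :
    ∃ W : ℝ, 0 < W ∧ ∀ r, |r| ≤ M → quot β κ r ≤ W := by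
  obtain ⟨C, hC⟩ := isCompact_Icc.exists_bound_of_continuousOn (s := Icc (-M) M)
    (hβ.continuous_deriv le_rfl).continuousOn
  refine ⟨|κ| + |C| + 1, by positivity, fun r hr => ?_⟩
  by_cases hr0 : r = 0
  · rw [quot, if_pos hr0]
    linarith [le_abs_self κ, abs_nonneg C]
  · obtain ⟨c, hc, hc'⟩ := quot_eq_deriv hβ hβ0 κ hr hr0
    rw [hc']
    have := (le_abs_self _).trans (hC c hc)
    linarith [le_abs_self C, abs_nonneg κ]

theorem quot_nonneg {β : ℝ → ℝ} (hβ : ContDiff ℝ 1 β) (hβ0 : β 0 = 0)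
    (hβ' : ∀ r, 0 ≤ deriv β r) {κ : ℝ} (hκ : 0 ≤ κ) (r : ℝ) : 0 ≤ quot β κ r := by
  by_cases hr0 : r = 0
  · rwa [quot, if_pos hr0]
  · obtain ⟨c, -, hc'⟩ := quot_eq_deriv hβ hβ0 κ le_rfl hr0
    rw [hc']
    exact hβ' c

theorem exists_le_quot {β : ℝ → ℝ} (hβ : ContDiff ℝ 1 β) (hβ0 : β 0 = 0)
    (hβ' : ∀ r, 0 < deriv β r) {κ : ℝ} (hκ : 0 < κ) {M : ℝ} (hM : 0 ≤ M) :
    ∃ α : ℝ, 0 < α ∧ ∀ r, |r| ≤ M → α ≤ quot β κ r := by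
  obtain ⟨m, -, hm⟩ := isCompact_Icc.exists_isMinOn (s := Icc (-M) M) ⟨0, by simpa using hM⟩
    (hβ.continuous_deriv le_rfl).continuousOn
  refine ⟨min κ (deriv β m), lt_min hκ (hβ' m), fun r hr => ?_⟩
  by_cases hr0 : r = 0
  · rw [quot, if_pos hr0]
    exact min_le_left _ _
  · obtain ⟨c, hc, hc'⟩ := quot_eq_deriv hβ hβ0 κ hr hr0
    rw [hc']
    exact (min_le_right _ _).trans (hm hc)

/-! ### Reduction of the theorem to zero datum. -/

theorem isSpaceTimeTest_mul {d : ℕ} {T : ℝ} {ψ : ℝ → ℝ} (hψ : ContDiff ℝ ∞ ψ)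
    (hψc : HasCompactSupport ψ) (hψT : tsupport ψ ⊆ Iio T) {f : RSpace d → ℝ}
    (hf : ContDiff ℝ ∞ f) (hfc : HasCompactSupport f) :
    IsSpaceTimeTest T (fun p : ℝ × RSpace d => ψ p.1 * f p.2) := by
  have h1 : tsupport (fun p : ℝ × RSpace d => ψ p.1 * f p.2) ⊆ tsupport ψ ×ˢ tsupport f := by
    refine closure_minimal (fun p hp => ?_) ((isClosed_tsupport _).prod (isClosed_tsupport _))
    exact ⟨subset_tsupport _ (left_ne_zero_of_mul hp), subset_tsupport _ (right_ne_zero_of_mul hp)⟩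
  exact ⟨(hψ.comp contDiff_fst).mul (hf.comp contDiff_snd),
    (hψc.isCompact.prod hfc.isCompact).of_isClosed_subset (isClosed_tsupport _) h1,
    h1.trans (prod_mono hψT (subset_univ _))⟩

theorem fracLaplacian_const_mul {d : ℕ} (s c : ℝ) (f : RSpace d → ℝ) (x : RSpace d) :
    fracLaplacian s (fun x => c * f x) x = c * fracLaplacian s f x := by
  simp only [fracLaplacian_eq_re, fracLaplacianC, fourierInv_eq_integral_planeWave,
    fourier_eq_integral_planeWave]
  rw [← Complex.re_ofReal_mul, ← integral_const_mul]
  refine congrArg Complex.re (integral_congr_ae (ae_of_all _ fun ξ => ?_))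
  simp only
  have h : ∫ y, planeWave ξ y * ((c * f y : ℝ) : ℂ) = c * ∫ y, planeWave ξ y * (f y : ℂ) := by
    rw [← integral_const_mul]
    refine integral_congr_ae (ae_of_all _ fun y => ?_)
    push_cast
    ring
  rw [h]
  ring

theorem inner_gradient_const_mul {d : ℕ} {f : RSpace d → ℝ} (hf : Differentiable ℝ f) (c : ℝ)
    (x v : RSpace d) :
    inner ℝ v (gradient (fun x => c * f x) x) = c * fderiv ℝ f x v := by
  rw [real_inner_comm, gradient, InnerProductSpace.toDual_symm_apply, fderiv_const_mul (hf x)]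
  rfl

/-- The weak formulation tested against a product, with the coefficients replaced by
representatives. -/
theorem IsLinearizedSolution.integral_product_eq {d : ℕ} {s T κ : ℝ} {β b : ℝ → ℝ}
    {D : RSpace d → RSpace d} {u : ℝ × RSpace d → ℝ} {u₀ : SignedMeasure (RSpace d)}
    {y : ℝ × RSpace d → ℝ} (h : IsLinearizedSolution s T κ β b D u u₀ y)
    {u' : ℝ × RSpace d → ℝ} (hu : u =ᵐ[cylinderMeasure d T] u') {D' : RSpace d → RSpace d}
    (hD : D =ᵐ[volume] D') {ψ : ℝ → ℝ} (hψ : ContDiff ℝ ∞ ψ)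
    (hψc : HasCompactSupport ψ) (hψT : tsupport ψ ⊆ Iio T) {f : RSpace d → ℝ}
    (hf : ContDiff ℝ ∞ f) (hfc : HasCompactSupport f) :
    ∫ p, (y p * (deriv ψ p.1 * f p.2) - (ψ p.1 * fracLaplacian s f p.2) *
      (quot β κ (u' p) * y p) + y p * (ψ p.1 * fderiv ℝ f p.2 (b (u' p) • D' p.2)))
      ∂(cylinderMeasure d T) = -integralSigned u₀ (fun x => ψ 0 * f x) := by
  rw [← add_eq_zero_iff_eq_neg]
  refine Eq.trans ?_ (h _ (isSpaceTimeTest_mul hψ hψc hψT hf hfc))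
  congr 1
  have hD2 : ∀ᵐ p ∂(cylinderMeasure d T), D p.2 = D' p.2 := by
    refine ae_restrict_of_ae ?_
    rw [Measure.volume_eq_prod]
    exact Measure.quasiMeasurePreserving_snd.ae hD
  refine integral_congr_ae ?_
  filter_upwards [hu, hD2] with p h1 h2
  simp only [fracLaplacian_const_mul, inner_gradient_const_mul (hf.differentiable (by simp)),
    deriv_mul_const (hψ.differentiable (by simp) p.1), h1, h2, map_smul, smul_eq_mul]
  ring

/-- Since `y` is only bounded, the factors coming from the test function must be in `L¹`; for
`(-Δ)^s f` this is `integrable_fracLaplacian`. It makes the difference of two weak formulations the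
integral of the difference. -/
theorem integrable_productIntegrand {d : ℕ} (hd : 1 ≤ d) {s T : ℝ} (hs : s ∈ Icc (1 / 2 : ℝ) 1)
    {y w : ℝ × RSpace d → ℝ} {v : ℝ × RSpace d → RSpace d} {W B : ℝ}
    (hy : MemLp y ⊤ (cylinderMeasure d T)) (hw : Measurable w) (hwb : ∀ p, ‖w p‖ ≤ W)
    (hv : Measurable v) (hvb : ∀ p, ‖v p‖ ≤ B) {ψ : ℝ → ℝ} (hψ : ContDiff ℝ ∞ ψ)
    (hψc : HasCompactSupport ψ) {f : RSpace d → ℝ}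
    (hf : ContDiff ℝ ∞ f) (hfc : HasCompactSupport f) :
    Integrable (fun p => y p * (deriv ψ p.1 * f p.2) - (ψ p.1 * fracLaplacian s f p.2) *
      (w p * y p) + y p * (ψ p.1 * fderiv ℝ f p.2 (v p))) (cylinderMeasure d T) := by
  have hyb : ∀ᵐ p ∂(cylinderMeasure d T), ‖y p‖ ≤ lpNorm y ⊤ (cylinderMeasure d T) :=
    ae_le_lpNorm_exponent_top hy
  have hψi : Integrable ψ := hψ.continuous.integrable_of_hasCompactSupport hψc
  have hψi' : Integrable (deriv ψ) :=
    (hψ.continuous_deriv (by simp)).integrable_of_hasCompactSupport hψc.deriv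
  have hfi : Integrable f := hf.continuous.integrable_of_hasCompactSupport hfc
  have i1 : Integrable (fun p : ℝ × RSpace d => deriv ψ p.1 * f p.2) (cylinderMeasure d T) :=
    Integrable.integrableOn (hψi'.mul_prod hfi)
  have i2 : Integrable (fun p : ℝ × RSpace d => ψ p.1 * fracLaplacian s f p.2)
      (cylinderMeasure d T) :=
    Integrable.integrableOn (hψi.mul_prod (integrable_fracLaplacian hd hs hf hfc))
  have hf' : Continuous (fderiv ℝ f) := hf.continuous_fderiv (by simp)
  have i3 : Integrable (fun p : ℝ × RSpace d => ψ p.1 * ‖fderiv ℝ f p.2‖)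
      (cylinderMeasure d T) :=
    Integrable.integrableOn (hψi.mul_prod
      (hf'.integrable_of_hasCompactSupport (hfc.fderiv ℝ)).norm)
  have i4 : Integrable (fun p : ℝ × RSpace d => ψ p.1 * fderiv ℝ f p.2 (v p))
      (cylinderMeasure d T) := by
    have e1 : Continuous (fun q : RSpace d × RSpace d => fderiv ℝ f q.1 q.2) :=
      (hf'.comp continuous_fst).clm_apply continuous_snd
    have e2 : Measurable (fun p : ℝ × RSpace d => fderiv ℝ f p.2 (v p)) :=
      e1.measurable.comp (measurable_snd.prodMk hv)
    refine (i3.norm.mul_const B).mono' ((hψ.continuous.measurable.comp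
      measurable_fst).mul e2).aestronglyMeasurable (ae_of_all _ fun p => ?_)
    rw [norm_mul, norm_mul, norm_norm, mul_assoc]
    exact mul_le_mul_of_nonneg_left ((fderiv ℝ f p.2).le_opNorm_of_le (hvb p)) (norm_nonneg _)
  have i5 : Integrable (fun p => (ψ p.1 * fracLaplacian s f p.2) * (w p * y p))
      (cylinderMeasure d T) := by
    have := (i2.bdd_mul hw.aestronglyMeasurable (ae_of_all _ hwb)).bdd_mul hy.1 hyb
    refine this.congr (ae_of_all _ fun p => ?_)
    simp only
    ring
  exact ((i1.bdd_mul hy.1 hyb).sub i5).add (i4.bdd_mul hy.1 hyb)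

/-- Uniqueness of distributional solutions of the linearized equation. The initial datum is already
encoded in the weak formulation, whose test functions need not vanish at `t = 0`, so the energy
argument uses neither the separate vanishing of `y₁ - y₂` at `t = 0` nor the `L^∞(0,T;L²)` bound
(boundedness and integrability of `y₁ - y₂` give square integrability in space-time). -/
theorem theorem3p2 (d : ℕ) (hd : 1 ≤ d) (s T κ : ℝ) (hs : s ∈ Set.Icc (1 / 2 : ℝ) 1) (hT : 0 < T)
    (β b : ℝ → ℝ) (D : RSpace d → RSpace d)
    (hβ : ContDiff ℝ 1 β) (hβ0 : β 0 = 0) (hb : ContDiff ℝ 1 b)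
    (hD : MemLp D ⊤ volume)
    (hcase : ((∀ r, 0 < deriv β r) ∧ 1 / 2 < s ∧ 0 < κ) ∨
      (D =ᵐ[volume] 0 ∧ (∀ r, 0 ≤ deriv β r) ∧ 0 ≤ κ))
    (u : ℝ × RSpace d → ℝ) (hu : MemLp u ⊤ (cylinderMeasure d T))
    (u₀ : SignedMeasure (RSpace d))
    (y₁ y₂ : ℝ × RSpace d → ℝ)
    (hy₁ : MemLp y₁ ⊤ (cylinderMeasure d T)) (hy₂ : MemLp y₂ ⊤ (cylinderMeasure d T))
    (hz1 : MemLp (y₁ - y₂) 1 (cylinderMeasure d T)) (hz2 : InLinftyL2 T (y₁ - y₂))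
    (hsol₁ : IsLinearizedSolution s T κ β b D u u₀ y₁)
    (hsol₂ : IsLinearizedSolution s T κ β b D u u₀ y₂)
    (hinit : VanishesAtZero (y₁ - y₂)) :
    y₁ =ᵐ[cylinderMeasure d T] y₂ := by
  have hcyl : MeasurableSet (cylinder d T) := measurableSet_Ioo.prod MeasurableSet.univ
  obtain ⟨u', M, hM, hu'm, hu'b, huu'⟩ := exists_bounded_measurable_rep hu
  obtain ⟨z₀, N, hN, hz₀m, hz₀b, hz₀⟩ := exists_bounded_measurable_rep (hy₁.sub hy₂)
  obtain ⟨D', L, hL, hD'm, hD'b, hDD', hD'0⟩ : ∃ (D' : RSpace d → RSpace d) (L : ℝ), 0 ≤ L ∧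
      Measurable D' ∧ (∀ x, ‖D' x‖ ≤ L) ∧ D =ᵐ[volume] D' ∧
      (((∀ r, 0 < deriv β r) ∧ 1 / 2 < s ∧ 0 < κ) ∨
      ((∀ x, D' x = 0) ∧ (∀ r, 0 ≤ deriv β r) ∧ 0 ≤ κ)) := by
    rcases hcase with h | ⟨h1, h2⟩
    · obtain ⟨D', L, hL, h1, h2, h3⟩ := exists_bounded_measurable_rep hD
      exact ⟨D', L, hL, h1, h2, h3, Or.inl h⟩
    -- The representative is chosen identically zero, so that `v` vanishes at every point.
    · exact ⟨0, 0, le_rfl, measurable_const, by simp, h1, Or.inr ⟨fun _ => rfl, h2⟩⟩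
  obtain ⟨W, hW, hWb⟩ := exists_quot_le hβ hβ0 κ M
  obtain ⟨b₀, hb₀⟩ := isCompact_Icc.exists_bound_of_continuousOn (s := Icc (-M) M)
    hb.continuous.continuousOn
  set w : ℝ × RSpace d → ℝ := fun p => quot β κ (u' p) with hw
  set v : ℝ × RSpace d → RSpace d := fun p => b (u' p) • D' p.2 with hv
  set z : ℝ × RSpace d → ℝ := (cylinder d T).indicator z₀ with hz
  have hwm : Measurable w := (measurable_quot hβ.continuous κ).comp hu'm
  have hvm : Measurable v := (hb.continuous.measurable.comp hu'm).smul (hD'm.comp measurable_snd)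
  have hw0 : ∀ p, 0 ≤ w p := fun p => by
    rcases hD'0 with h | h
    · exact quot_nonneg hβ hβ0 (fun r => (h.1 r).le) h.2.2.le _
    · exact quot_nonneg hβ hβ0 h.2.1 h.2.2 _
  have hwW : ∀ p, w p ≤ W := fun p => hWb _ (hu'b p)
  have hvB : ∀ p, ‖v p‖ ≤ b₀ * L := fun p => by
    rw [hv, norm_smul]
    have h1 := hb₀ (u' p) (abs_le.1 (hu'b p))
    exact mul_le_mul h1 (hD'b _) (norm_nonneg _) ((norm_nonneg _).trans h1)
  have hzi : Integrable z := by
    rw [hz, integrable_indicator_iff hcyl]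
    exact (memLp_one_iff_integrable.1 hz1).congr hz₀
  have hsol : IsZeroDataSolution s T z w v W (b₀ * L) := by
    refine ⟨hz₀m.indicator hcyl, hwm, hvm, hzi, ?_, fun t ht x => ?_, hw0, hwW, hvB,
      fun ψ hψ hψc hψT f hf hfc => ?_⟩
    · simp only [sq]
      refine hzi.bdd_mul (c := N) (hz₀m.indicator hcyl).aestronglyMeasurable (ae_of_all _ fun p => ?_)
      exact (norm_indicator_le_norm_self _ _).trans (hz₀b p)
    · exact indicator_of_notMem (fun h => ht h.1) _
    · have i1 := integrable_productIntegrand (s := s) hd hs hy₁ hwm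
        (fun p => (Real.norm_of_nonneg (hw0 p)).le.trans (hwW p)) hvm hvB hψ hψc hf hfc
      have i2 := integrable_productIntegrand (s := s) hd hs hy₂ hwm
        (fun p => (Real.norm_of_nonneg (hw0 p)).le.trans (hwW p)) hvm hvB hψ hψc hf hfc
      have e1 := hsol₁.integral_product_eq huu' hDD' hψ hψc hψT hf hfc
      have e2 := hsol₂.integral_product_eq huu' hDD' hψ hψc hψT hf hfc
      have e3 := integral_sub i1 i2
      simp only [hw, hv] at e3
      -- The initial datum is common to both solutions and cancels.
      rw [e1, e2, sub_self] at e3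
      rw [← e3, cylinderMeasure, ← integral_indicator hcyl]
      have hae := (ae_restrict_iff' hcyl).1 hz₀
      refine integral_congr_ae ?_
      filter_upwards [hae] with p hp
      by_cases hpc : p ∈ cylinder d T
      · have h1 := hp hpc
        simp only [Pi.sub_apply] at h1
        rw [indicator_of_mem hpc, hz, indicator_of_mem hpc, ← h1]
        ring
      · rw [indicator_of_notMem hpc, hz, indicator_of_notMem hpc]
        ring
  have hzero : z =ᵐ[volume] 0 := by
    rcases hD'0 with ⟨h1, h2, h3⟩ | ⟨h1, h2, h3⟩
    · obtain ⟨α, hα, hαb⟩ := exists_le_quot hβ hβ0 h1 h3 hM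
      -- This is `k₁`, chosen so that `k₁ ‖v‖² ≤ α/2`; with `k₂ = α/2` the sum stays below `α ≤ w`.
      -- Taking `η = k₁ α/2` and `K = C/k₁` makes `k₁ (k₂ + K/(1+q))` equal to `η + C/(1+q)`.
      have hk : 0 < α / (2 * ((b₀ * L) ^ 2 + 1)) := by positivity
      obtain ⟨C, hC, hCb⟩ := exists_drift_symbol_le h2 (mul_pos hk (half_pos hα))
      refine hsol.ae_eq_zero hs.1 hs.2 hT hk.le (half_pos hα).le
        (div_nonneg hC hk.le) hW (Or.inr fun ξ => (hCb d ξ).trans (le_of_eq ?_)) fun p => ?_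
      · generalize α / (2 * ((b₀ * L) ^ 2 + 1)) = k at hk
        field_simp
      · have e1 : ‖v p‖ ^ 2 ≤ (b₀ * L) ^ 2 := pow_le_pow_left₀ (norm_nonneg _) (hvB p) 2
        have e2 : α / (2 * ((b₀ * L) ^ 2 + 1)) * ‖v p‖ ^ 2 ≤ α / 2 := by
          rw [div_mul_eq_mul_div, div_le_iff₀ (by positivity)]
          nlinarith
        have e3 : α ≤ w p := hαb _ (hu'b p)
        linarith
    -- Without drift, `k₁ = k₂ = K = 0` and only `w ≥ 0` is required.
    · refine hsol.ae_eq_zero hs.1 hs.2 hT le_rfl le_rfl le_rfl hW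
        (Or.inl fun p => by simp [hv, h1]) fun p => ?_
      simpa using hw0 p
  have h1 : ∀ᵐ p ∂(cylinderMeasure d T), z p = 0 := ae_restrict_of_ae hzero
  filter_upwards [h1, hz₀, ae_restrict_mem hcyl] with p h2 h3 h4
  rw [hz, indicator_of_mem h4] at h2
  rw [h2, Pi.sub_apply] at h3
  linarith
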